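/- **Setting.** Let $1\le T\le N$ be integers and $\alpha\in[0,1)$; write $[a:b]=\{a,a+1,\dots,b\}$. Tokens are $x\in[1:N]$ and messages are $m\in[1:T]$; the decoder output $0$ means "no watermark". Let $P_X$ be a probability distribution on $[1:N]$. A *scheme* with finite key space $\mathcal Z$ consists of a decoder $\gamma:[1:N]\times\mathcal Z\to[0:T]$, a distribution $P_Z$ on $\mathcal Z$ and distributions $P_m$ on $[1:N]\times\mathcal Z$, $m\in[1:T]$. It is *feasible* if $\sum_\zeta P_m(x,\zeta)=P_X(x)$ for all $m,x$, $\sum_xP_m(x,\zeta)=P_Z(\zeta)$ for all $m,\zeta$, and $\sum_{x,\zeta}Q_X(x)P_Z(\zeta)\mathbf 1\{\gamma(x,\zeta)\ne0\}\le\alpha$ for every distribution $Q_X$ on $[1:N]$. Its worst-case miss-detection error is $\max_m\sum_{x,\zeta}P_m(x,\zeta)\mathbf 1\{\gamma(x,\zeta)\neq m\}$. The reduced key set $\mathcal Z_T^N\subset[0:T]^N$ consists of all permutations of $(1,2,\dots,T,0,\dots,0)$ and of the zero vector $\mathbf 0_N$; its decoder is $\gamma(x,\zeta)=\zeta_x$.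 Put $\gamma_x^{-1}(m)=\{\zeta\in\mathcal Z^N_T:\zeta_x=m\}$. Let $\Omega_T$ be the set of vectors in $\{0,1\}^N$ with exactly $T$ ones; a vector is *$T$-hot representable* if it equals $\sum_{\omega\in\Omega_T}\lambda_\omega\,\omega$ with all $\lambda_\omega\ge0$. **Split.** Let $P_X(1)\le\dots\le P_X(N)$, $a(x)=\min(\alpha/T,P_X(x))$ and $\tilde K=|\{x:P_X(x)\ge\alpha/T\}|$. If $a$ is $T$-hot representable, set $P_X^{(1)}=a$. Otherwise let $k$ be the smallest integer in $[\tilde K:T-1]$ with $y:=\frac1{T-k}\sum_{i=1}^{N-k}a(i)\ge a(N-k)$, and set $P_X^{(1)}=(a(1),\dots,a(N-k),y,\dots,y)$. In both cases set $P_X^{(2)}=a-P_X^{(1)}$ and $P_X^{(3)}(x)=\max(P_X(x)-\alpha/T,0)$. **Tables.** Let $P_X^{(1)}=\sum_{\omega\in\Omega_T}\lambda_\omega\,\omega$ with $\lambda_\omega\ge0$. Let $K$ be the number of nonzero entries of $P_X^{(2)}$, $\Delta_j=P_X^{(2)}(N-j+1)-P_X^{(2)}(N-j)$ for $j\in[1:K]$,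 $S=\{\zeta\in\mathcal Z_T^N:\mathrm{supp}(P_X^{(2)})\subset\mathrm{supp}(\zeta)\}$, $S_{m,j}=S\setminus\bigcup_{l=N-j+1}^N\gamma_l^{-1}(m)$ and $R=\sum_xP_X^{(3)}(x)$. For $m\in[1:T]$, $x\in[1:N]$ and $\zeta\in\mathcal Z_T^N$ define - $P_m^{(1)}(x,\zeta)=\lambda_\omega/(T-1)!$ if $\zeta_x=m$ and $\omega\in\Omega_T$ has the same support as $\zeta$, and $0$ if $\zeta_x\ne m$; - $P_m^{(2)}(x,\zeta)=\sum_{j=1}^K\mathbf 1\{x\ge N-j+1,\ \zeta\in S\cap\gamma_x^{-1}(m)\}\,\dfrac{\Delta_j}{|S\cap\gamma_x^{-1}(m)|}$; - $P_m^{(3)}(x,\zeta)=\sum_{j=1}^K\mathbf 1\{x\ge N-\tilde K+1,\ \zeta\in S_{m,j}\}\,\dfrac{\Delta_j(T-j)}{|S_{m,j}|}\cdot\dfrac{P_X^{(3)}(x)}R$ for $\zeta\ne\mathbf 0_N$, and $P_m^{(3)}(x,\mathbf 0_N)=P_X^{(3)}(x)\,(1-U_m/R)$, where $U_m=\sum_\zeta\bigl(\max_\mu\sum_xP_\mu^{(2)}(x,\zeta)-\sum_xP_m^{(2)}(x,\zeta)\bigr)$;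 if $R=0$, then $P_m^{(3)}=0$. **Proposition.** (1) Let $P_X$ be non-decreasing. Then $P_X=P_X^{(1)}+P_X^{(2)}+P_X^{(3)}$, the vector $P_X^{(1)}$ is $T$-hot representable, and $P_X^{(2)}$ is non-negative and non-decreasing with $K\le T-1$ nonzero entries, which are its last $K$ entries. For every choice of the weights $\lambda_\omega$, the tables $P_m=P_m^{(1)}+P_m^{(2)}+P_m^{(3)}$, $m\in[1:T]$, are probability distributions on $[1:N]\times\mathcal Z_T^N$ with - row-sum invariance: $\sum_xP_m(x,\zeta)=:P_Z(\zeta)$ does not depend on $m$; - column-sum invariance: $\sum_\zeta P_m(x,\zeta)=P_X(x)$ for all $m$ and $x$; - $\frac\alpha T$-capped column sum: $\sum_\zeta P_m(x,\zeta)\mathbf 1\{\gamma(x,\zeta)=m\}\ge\min(\frac\alpha T,P_X(x))$ for all $m$ and $x$; - $\alpha$-bounded total sum: $\sum_{m=1}^T\sum_\zeta P_Z(\zeta)\mathbf 1\{\gamma(x,\zeta)=m\}\le\alpha$ for all $x$. Hence $(\gamma,P_Z,(P_m)_m)$ is a feasible scheme, its worst-case miss-detection error equals $1-\sum_x\min(\frac\alpha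 T,P_X(x))$, and this is the smallest worst-case miss-detection error of all feasible schemes over all finite key spaces. (2) $|\mathcal Z_T^N|=\frac{N!}{(N-T)!}+1$, and for every distribution $P_X$ on $[1:N]$, non-decreasing or not, some feasible scheme with key set $\mathcal Z_T^N$ and decoder $\gamma(x,\zeta)=\zeta_x$ attains this optimum $1-\sum_x\min(\frac\alpha T,P_X(x))$. -/

import Mathlib

open scoped Nat

namespace Watermark

noncomputable section

/-! ### Watermarking schemes over an arbitrary finite key space

Tokens are `Fin N` (the token `x : Fin N` stands for `x + 1` in `{1, …, N}`).  Messages are `Fin T`; the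
message `m : Fin T` is the decoder output `m.succ : Fin (T + 1)`, and the output `0` means that no
watermark is detected. -/

section Schemes

/-- Probability, under the joint law `Q` of token and key, that the decoder `γ` does not output
`m`. -/
def detectionError {N T : ℕ} {Z : Type} [Fintype Z] (γ : Fin N → Z → Fin (T + 1))
    (m : Fin (T + 1)) (Q : Fin N → Z → ℝ) : ℝ :=
  ∑ x, ∑ ζ, Q x ζ * (if γ x ζ ≠ m then 1 else 0)

/-- Worst-case miss-detection error, the maximum over the `T` messages. -/
def worstMiss {N T : ℕ} {Z : Type} [Fintype Z] (γ : Fin N → Z → Fin (T + 1))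
    (Q : Fin T → Fin N → Z → ℝ) : ℝ :=
  ⨆ m : Fin T, detectionError γ m.succ (Q m)

/-- Row sum of a table: the marginal on the key space. -/
def keyMarginal {N : ℕ} {Z : Type} (Q : Fin N → Z → ℝ) (ζ : Z) : ℝ := ∑ x, Q x ζ

/-- Every table `Q m` has column sums `V`. -/
def ColumnSumInvariant {N T : ℕ} {Z : Type} [Fintype Z] (V : Fin N → ℝ)
    (Q : Fin T → Fin N → Z → ℝ) : Prop :=
  ∀ m x, ∑ ζ, Q m x ζ = V x

/-- All tables `Q m` have the same row sums. -/
def RowSumInvariant {N T : ℕ} {Z : Type} (Q : Fin T → Fin N → Z → ℝ) : Prop :=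
  ∀ m m' ζ, keyMarginal (Q m) ζ = keyMarginal (Q m') ζ

/-- `α / T`-capped column sum. -/
def CappedColumnSum {N T : ℕ} {Z : Type} [Fintype Z] (α : ℝ) (P : Fin N → ℝ)
    (γ : Fin N → Z → Fin (T + 1)) (Q : Fin T → Fin N → Z → ℝ) : Prop :=
  ∀ m x, min (α / T) (P x) ≤ ∑ ζ, Q m x ζ * (if γ x ζ = m.succ then 1 else 0)

/-- `α`-bounded total sum, for the key distribution `PZ`. -/
def BoundedTotalSum {N T : ℕ} {Z : Type} [Fintype Z] (α : ℝ)
    (γ : Fin N → Z → Fin (T + 1)) (PZ : Z → ℝ) : Prop :=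
  ∀ x, ∑ m : Fin T, ∑ ζ, PZ ζ * (if γ x ζ = m.succ then 1 else 0) ≤ α

/-- `(γ, PZ, Q)` is a distortionless scheme for the token distribution `P`
whose false-alarm error is at most `α` for every token distribution. -/
structure IsFeasible {N T : ℕ} {Z : Type} [Fintype Z] (α : ℝ) (P : Fin N → ℝ)
    (γ : Fin N → Z → Fin (T + 1)) (PZ : Z → ℝ) (Q : Fin T → Fin N → Z → ℝ) : Prop where
  key_mem : PZ ∈ stdSimplex ℝ Z
  table_mem : ∀ m, (fun p : Fin N × Z => Q m p.1 p.2) ∈ stdSimplex ℝ (Fin N × Z)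
  false_alarm : ∀ QX ∈ stdSimplex ℝ (Fin N), detectionError γ 0 (fun x ζ => QX x * PZ ζ) ≤ α
  column_sum : ∀ m x, ∑ ζ, Q m x ζ = P x
  row_sum : ∀ m ζ, ∑ x, Q m x ζ = PZ ζ

/-- All worst-case miss-detection errors of feasible schemes with `T` messages, over all finite
key spaces, decoders, key distributions and tables. -/
def attainableErrors {N : ℕ} (T : ℕ) (α : ℝ) (P : Fin N → ℝ) : Set ℝ :=
  {b | ∃ (Z : Type) (_ : Fintype Z) (γ : Fin N → Z → Fin (T + 1)) (PZ : Z → ℝ)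
      (Q : Fin T → Fin N → Z → ℝ), IsFeasible α P γ PZ Q ∧ b = worstMiss γ Q}

end Schemes

/-! ### The reduced key set and its decoder -/

section Keys

/-- The canonical key `(1, 2, …, T, 0, …, 0)` of length `N`. -/
def canonicalKey (N T : ℕ) (i : Fin N) : Fin (T + 1) :=
  if h : i.val < T then ⟨i.val + 1, Nat.succ_lt_succ h⟩ else 0

/-- All permutations of the canonical key, together with the all-zero key. -/
def reducedKeySet (N T : ℕ) : Finset (Fin N → Fin (T + 1)) :=
  insert 0 (Finset.univ.image fun π : Equiv.Perm (Fin N) => fun i => canonicalKey N T (π i))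

/-- The reduced key set as a type. -/
abbrev Key (N T : ℕ) : Type := {ζ : Fin N → Fin (T + 1) // ζ ∈ reducedKeySet N T}

/-- The decoder: a key lists the decoded value of every token. -/
def decoder (N T : ℕ) (x : Fin N) (ζ : Key N T) : Fin (T + 1) := ζ.1 x

/-- The keys that decode `x` to the message `m`. -/
def slice {N T : ℕ} (x : Fin N) (m : Fin T) : Finset (Key N T) :=
  Finset.univ.filter fun ζ => decoder N T x ζ = m.succ

end Keys

/-! ### The split of the token distribution -/

section Split

/-- The entry `v(i)` for `i ∈ [1:N]` (indices start at `1`), and `0` for other `i`. -/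
def entry {N : ℕ} (v : Fin N → ℝ) (i : ℕ) : ℝ :=
  if h : 1 ≤ i ∧ i ≤ N then v ⟨i - 1, by omega⟩ else 0

/-- The last `j` tokens. -/
def tail (N j : ℕ) : Finset (Fin N) := Finset.univ.filter fun x => N ≤ x.val + j

/-- The `T`-hot vectors of length `N`. -/
def hotVectors (N T : ℕ) : Finset (Fin N → Fin 2) :=
  Finset.univ.filter fun ω => ∑ i, (ω i).val = T

/-- `w` is a family of non-negative weights that writes `v` as a sum of `T`-hot vectors. -/
def IsHotRepresentation {N : ℕ} (T : ℕ) (w : (Fin N → Fin 2) → ℝ) (v : Fin N → ℝ) : Prop :=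
  (∀ ω ∈ hotVectors N T, 0 ≤ w ω) ∧
    ∀ i, v i = ∑ ω ∈ hotVectors N T, w ω * ((ω i).val : ℝ)

/-- `T`-hot representability. -/
def IsHotRepresentable {N : ℕ} (T : ℕ) (v : Fin N → ℝ) : Prop :=
  ∃ w, IsHotRepresentation T w v

/-- The capped vector `min (α / T) P`. -/
def capped {N : ℕ} (T : ℕ) (α : ℝ) (P : Fin N → ℝ) (x : Fin N) : ℝ := min (α / T) (P x)

/-- The number of entries of `P` that are at least `α / T`. -/
def numLarge {N : ℕ} (T : ℕ) (α : ℝ) (P : Fin N → ℝ) : ℕ :=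
  (Finset.univ.filter fun x => α / T ≤ P x).card

/-- The leveling value `(a(1) + ⋯ + a(N - k)) / (T - k)`. -/
def level {N : ℕ} (T : ℕ) (a : Fin N → ℝ) (k : ℕ) : ℝ :=
  (∑ i ∈ Finset.Icc 1 (N - k), entry a i) / ((T : ℝ) - k)

/-- The first `k = K₀, …, T - 1` at which the leveling value is at least `a(N - k)`. -/
def levelIndex {N : ℕ} (T K₀ : ℕ) (a : Fin N → ℝ) : ℕ :=
  sInf {k | K₀ ≤ k ∧ k < T ∧ entry a (N - k) ≤ level T a k}

open Classical in
/-- First part of the split: the capped vector `a` if it is `T`-hot representable, and otherwise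
`a` with its last `k` entries replaced by the leveling value, `k` the leveling index. -/
def part₁ {N : ℕ} (T : ℕ) (α : ℝ) (P : Fin N → ℝ) (x : Fin N) : ℝ :=
  if IsHotRepresentable T (capped T α P) then capped T α P x
  else
    if x ∈ tail N (levelIndex T (numLarge T α P) (capped T α P)) then
      level T (capped T α P) (levelIndex T (numLarge T α P) (capped T α P))
    else capped T α P x

/-- Second part of the split. -/
def part₂ {N : ℕ} (T : ℕ) (α : ℝ) (P : Fin N → ℝ) (x : Fin N) : ℝ :=
  capped T α P x - part₁ T α P x

/-- Third part of the split. -/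
def part₃ {N : ℕ} (T : ℕ) (α : ℝ) (P : Fin N → ℝ) (x : Fin N) : ℝ := max (P x - α / T) 0

end Split

/-! ### The three tables -/

section Tables

/-- The keys with the same support as `ω`. -/
def keysOn {N T : ℕ} (ω : Fin N → Fin 2) : Finset (Key N T) :=
  Finset.univ.filter fun ζ => ∀ i, ζ.1 i ≠ 0 ↔ ω i ≠ 0

/-- First table: each `T`-hot vector `ω` contributes `w ω / (T - 1)!` to every pair `(x, ζ)` that
decodes to `m` and whose key has the support of `ω`. -/
def table₁ {N T : ℕ} (w : (Fin N → Fin 2) → ℝ) (m : Fin T) (x : Fin N) (ζ : Key N T) : ℝ :=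
  ∑ ω ∈ hotVectors N T, if ζ ∈ keysOn ω ∧ ζ ∈ slice x m then w ω / ((T - 1)! : ℕ) else 0

/-- The number of nonzero entries. -/
def numNonzero {N : ℕ} (v : Fin N → ℝ) : ℕ := (Finset.univ.filter fun x => v x ≠ 0).card

/-- The anchored keys: those whose support contains the support of `v`. -/
def anchored {N : ℕ} (T : ℕ) (v : Fin N → ℝ) : Finset (Key N T) :=
  Finset.univ.filter fun ζ => ∀ x, v x ≠ 0 → ζ.1 x ≠ 0

/-- The increment `v(N - j + 1) - v(N - j)`, the weight of the step vector with `j` ones. -/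
def increment {N : ℕ} (v : Fin N → ℝ) (j : ℕ) : ℝ := entry v (N - j + 1) - entry v (N - j)

/-- Second table: layer `j` spreads, for each of the last `j` tokens `x`, the increment evenly over
the anchored keys that decode `x` to `m`. -/
def table₂ {N T : ℕ} (v : Fin N → ℝ) (m : Fin T) (x : Fin N) (ζ : Key N T) : ℝ :=
  ∑ j ∈ Finset.Icc 1 (numNonzero v),
    if x ∈ tail N j ∧ ζ ∈ anchored T v ∩ slice x m then
      increment v j / ((anchored T v ∩ slice x m).card : ℝ) else 0

/-- Row-sum imbalance of the tables `Q` at the key `ζ`. -/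
def imbalance {N T : ℕ} (Q : Fin T → Fin N → Key N T → ℝ) (m : Fin T) (ζ : Key N T) : ℝ :=
  (⨆ μ : Fin T, ∑ x, Q μ x ζ) - ∑ x, Q m x ζ

/-- Total row-sum imbalance. -/
def totalImbalance {N T : ℕ} (Q : Fin T → Fin N → Key N T → ℝ) (m : Fin T) : ℝ :=
  ∑ ζ, imbalance Q m ζ

/-- The anchored keys that decode none of the last `j` tokens to `m`. -/
def missing {N T : ℕ} (v : Fin N → ℝ) (m : Fin T) (j : ℕ) : Finset (Key N T) :=
  anchored T v \ (tail N j).biUnion fun l => slice l m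

/-- Third table: `v` is the second part of the split, `r` the third one, `K₀` the number of tokens
that may receive mass, `U` the total imbalance. -/
def table₃ {N T : ℕ} (v r : Fin N → ℝ) (K₀ : ℕ) (U : ℝ) (m : Fin T) (x : Fin N)
    (ζ : Key N T) : ℝ :=
  if ζ.1 = 0 then r x * (1 - U / ∑ i, r i)
  else
    ∑ j ∈ Finset.Icc 1 (numNonzero v),
      if x ∈ tail N K₀ ∧ ζ ∈ missing v m j then
        increment v j * ((T : ℝ) - j) / ((missing v m j).card : ℝ) * (r x / ∑ i, r i) else 0

/-- The tables `P_m`, built from weights `w` of a `T`-hot representation of the first part. -/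
def constructionA {N T : ℕ} (α : ℝ) (P : Fin N → ℝ) (w : (Fin N → Fin 2) → ℝ)
    (m : Fin T) (x : Fin N) (ζ : Key N T) : ℝ :=
  table₁ w m x ζ + table₂ (part₂ T α P) m x ζ +
    table₃ (part₂ T α P) (part₃ T α P) (numLarge T α P)
      (totalImbalance (T := T) (table₂ (part₂ T α P)) m) m x ζ

end Tables

end

end Watermark

open Watermark

namespace Watermark

/-! Converse: fix a token x and add up, over all messages, the mass decoded correctly at x. Row sums
bound it by the probability under `PZ` that x decodes to a nonzero value, which is at most α by the
false-alarm condition for the point mass at x; column sums bound it by T · P(x). Averaging over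
messages gives the lower bound `IsFeasible.le_worstMiss`.

Achievability: a nonzero key is an injection of messages into tokens, so each message sits on
exactly one token of the key. A vector a is a non-negative combination of T-hot vectors exactly when
a ≥ 0 and T · a(i) ≤ ∑ a (`isHotRepresentable_iff`). Spreading each T-hot vector evenly over the
labellings of its support gives row sums that do not depend on the message. If the capped vector
violates the criterion, its last k < T entries are levelled down to satisfy it, and the excess v =
`part₂` is spread evenly over the set S of anchored keys. The row sum of message m at such a key is
then v(x₀) · T / |S|, with x₀ the token carrying m; the largest one is v(N) · T / |S|. The third
table fills the difference with mass of `part₃` and leaves the rest on the zero key.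

Two inequalities make this work: the total deficit T · v(N) - ∑ v is at most ∑ `part₃`, and T ·
(`part₁` x + v(N)) ≤ α. Both come from the choice of the leveling index (`levelIndex_spec`,
`splitSpec`). A general token distribution is reduced to the monotone case by sorting. -/

/-! ### Keys as injections of messages into tokens -/

theorem exists_perm_extending (N T : ℕ) (x y : Fin T ↪ Fin N) : ∃ g : Equiv.Perm (Fin N), ∀ m, g (x m) = y m := by
  obtain ⟨g, hg⟩ := (Equiv.Perm.isMultiplyPretransitive (Fin N) T).exists_smul_eq x y
  exact ⟨g, fun m => by simpa using congrArg (fun e : Fin T ↪ Fin N => e m) hg⟩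

open Classical in
/-- The key that decodes the token `e m` to the message `m`, and all other tokens to `0`. -/
noncomputable def keyOfEmbedding {N T : ℕ} (e : Fin T ↪ Fin N) (x : Fin N) : Fin (T + 1) :=
  if h : ∃ m, e m = x then h.choose.succ else 0

theorem keyOfEmbedding_eq_succ {N T : ℕ} (e : Fin T ↪ Fin N) (x : Fin N) (m : Fin T) :
    keyOfEmbedding e x = m.succ ↔ e m = x := by
  unfold keyOfEmbedding
  split_ifs with h
  · rw [Fin.succ_inj]
    constructor
    · rintro rfl; exact h.choose_spec
    · intro h'; exact e.injective (h.choose_spec.trans h'.symm)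
  · exact ⟨fun h' => absurd h'.symm (Fin.succ_ne_zero m), fun h' => absurd ⟨m, h'⟩ h⟩

theorem keyOfEmbedding_ne_zero {N T : ℕ} (e : Fin T ↪ Fin N) (x : Fin N) :
    keyOfEmbedding e x ≠ 0 ↔ ∃ m, e m = x := by
  unfold keyOfEmbedding
  split_ifs with h <;> simp [h]

/-- Equality of keys can thus be tested on nonzero outputs only, where `keyOfEmbedding_eq_succ` and
`canonicalKey_eq_succ` apply. -/
theorem eq_of_eq_succ_iff {T : ℕ} {a b : Fin (T + 1)} (h : ∀ m : Fin T, a = m.succ ↔ b = m.succ) :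
    a = b := by
  rcases Fin.eq_zero_or_eq_succ a with rfl | ⟨m, rfl⟩
  · rcases Fin.eq_zero_or_eq_succ b with rfl | ⟨m, rfl⟩
    · rfl
    · exact (h m).2 rfl
  · exact ((h m).1 rfl).symm

theorem keyOfEmbedding_injective {N T : ℕ} :
    Function.Injective (keyOfEmbedding : (Fin T ↪ Fin N) → Fin N → Fin (T + 1)) := by
  intro e e' h
  ext m : 1
  have h1 := (keyOfEmbedding_eq_succ e (e m) m).2 rfl
  rw [h, keyOfEmbedding_eq_succ] at h1
  exact h1.symm

theorem canonicalKey_eq_succ {N T : ℕ} (i : Fin N) (m : Fin T) :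
    canonicalKey N T i = m.succ ↔ i.val = m.val := by
  unfold canonicalKey
  split_ifs with h
  · simp [Fin.ext_iff]
  · have := m.isLt
    refine ⟨fun h' => absurd h'.symm (Fin.succ_ne_zero m), fun h' => by omega⟩

/-- A rearrangement of the canonical key is determined by where the T messages land. Conversely,
every injection extends to a permutation, by multiple transitivity of the symmetric group. -/
theorem reducedKeySet_eq {N T : ℕ} (hTN : T ≤ N) :
    reducedKeySet N T = insert 0 (Finset.univ.image keyOfEmbedding) := by
  unfold reducedKeySet
  congr 1
  ext ζ
  simp only [Finset.mem_image, Finset.mem_univ, true_and]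
  constructor
  · rintro ⟨π, rfl⟩
    refine ⟨(Fin.castLEEmb hTN).trans π.symm.toEmbedding, funext fun x => eq_of_eq_succ_iff fun m => ?_⟩
    rw [keyOfEmbedding_eq_succ, canonicalKey_eq_succ]
    simp only [Function.Embedding.trans_apply, Equiv.coe_toEmbedding, Equiv.symm_apply_eq,
      Fin.ext_iff]
    exact eq_comm
  · rintro ⟨e, rfl⟩
    obtain ⟨π, hπ⟩ := exists_perm_extending N T e (Fin.castLEEmb hTN)
    refine ⟨π, funext fun x => eq_of_eq_succ_iff fun m => ?_⟩
    rw [keyOfEmbedding_eq_succ, canonicalKey_eq_succ]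
    rw [← π.injective.eq_iff, hπ, Fin.ext_iff]
    exact eq_comm

theorem keyOfEmbedding_fun_ne_zero {N T : ℕ} (hT : 1 ≤ T) (e : Fin T ↪ Fin N) :
    keyOfEmbedding e ≠ 0 := fun h =>
  (keyOfEmbedding_ne_zero e (e ⟨0, hT⟩)).2 ⟨_, rfl⟩ (congrFun h _)

theorem card_reducedKeySet {N T : ℕ} (hT : 1 ≤ T) (hTN : T ≤ N) :
    (reducedKeySet N T).card = N ! / (N - T)! + 1 := by
  rw [reducedKeySet_eq hTN, Finset.card_insert_of_notMem,
    Finset.card_image_of_injective _ keyOfEmbedding_injective, Finset.card_univ,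
    Fintype.card_embedding_eq, Fintype.card_fin, Fintype.card_fin, Nat.descFactorial_eq_div hTN]
  simp only [Finset.mem_image, Finset.mem_univ, true_and, not_exists]
  exact keyOfEmbedding_fun_ne_zero hT

/-- `keyOfEmbedding` as an element of the reduced key set. -/
noncomputable def embeddingKey {N T : ℕ} (hTN : T ≤ N) (e : Fin T ↪ Fin N) : Key N T :=
  ⟨keyOfEmbedding e, by
    rw [reducedKeySet_eq hTN]
    exact Finset.mem_insert_of_mem (Finset.mem_image_of_mem _ (Finset.mem_univ e))⟩

theorem embeddingKey_injective {N T : ℕ} (hTN : T ≤ N) :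
    Function.Injective (embeddingKey hTN) := fun _ _ h =>
  keyOfEmbedding_injective (congrArg Subtype.val h)

theorem exists_embeddingKey {N T : ℕ} (hTN : T ≤ N) (ζ : Key N T) (hζ : ζ.1 ≠ 0) :
    ∃ e, embeddingKey hTN e = ζ := by
  have h := (Finset.ext_iff.1 (reducedKeySet_eq hTN) ζ.1).1 ζ.2
  rw [Finset.mem_insert, Finset.mem_image] at h
  obtain h | ⟨e, -, h⟩ := h
  · exact absurd h hζ
  · exact ⟨e, Subtype.ext h⟩

theorem mem_slice {N T : ℕ} {x : Fin N} {m : Fin T} {ζ : Key N T} :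
    ζ ∈ slice x m ↔ ζ.1 x = m.succ := by
  rw [slice, Finset.mem_filter]
  exact and_iff_right (Finset.mem_univ ζ)

/-- This is why row sums are computable: for a fixed nonzero key and message, a sum over tokens
restricted to correct decoding has a single term. -/
theorem exists_mem_slice {N T : ℕ} (hTN : T ≤ N) (ζ : Key N T) (hζ : ζ.1 ≠ 0) (m : Fin T) :
    ∃ x, ∀ y, ζ ∈ slice y m ↔ y = x := by
  obtain ⟨e, rfl⟩ := exists_embeddingKey hTN ζ hζ
  refine ⟨e m, fun y => ?_⟩
  rw [mem_slice, eq_comm (a := y)]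
  exact keyOfEmbedding_eq_succ e y m

theorem ne_zero_of_mem_slice {N T : ℕ} {x : Fin N} {m : Fin T} {ζ : Key N T} (h : ζ ∈ slice x m) :
    ζ.1 ≠ 0 := fun h0 => by
  rw [mem_slice, h0] at h
  exact Fin.succ_ne_zero m h.symm

/-! ### Symmetries of the key set and key counts -/

/-- Keys are stable under a permutation of tokens and a permutation of the decoder outputs that
fixes `0`. -/
theorem relabel_mem {N T : ℕ} (σ : Equiv.Perm (Fin N)) (τ : Equiv.Perm (Fin T))
    (hTN : T ≤ N) {ζ ζ' : Fin N → Fin (T + 1)} (hζ : ζ ∈ reducedKeySet N T)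
    (h : ∀ x m, ζ' x = m.succ ↔ ζ (σ x) = (τ m).succ) : ζ' ∈ reducedKeySet N T := by
  rw [reducedKeySet_eq hTN, Finset.mem_insert, Finset.mem_image] at hζ ⊢
  obtain rfl | ⟨e, -, rfl⟩ := hζ
  · left
    funext x
    refine eq_of_eq_succ_iff fun m => ?_
    rw [h]
    simp [(Fin.succ_ne_zero _).symm]
  · right
    -- The new key decodes x to m iff e (τ m) = σ x, so m sits on σ⁻¹ (e (τ m)).
    refine ⟨(τ.toEmbedding.trans e).trans σ.symm.toEmbedding, Finset.mem_univ _,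
      funext fun x => eq_of_eq_succ_iff fun m => ?_⟩
    rw [h, keyOfEmbedding_eq_succ, keyOfEmbedding_eq_succ]
    simp [Equiv.symm_apply_eq]

/-- Exchange two messages in a key. -/
def swapKey {N T : ℕ} (hTN : T ≤ N) (m m' : Fin T) (ζ : Key N T) : Key N T :=
  ⟨fun x => Equiv.swap m.succ m'.succ (ζ.1 x),
    relabel_mem (Equiv.refl _) (Equiv.swap m m') hTN ζ.2 fun x n => by
      rw [Equiv.swap_apply_eq_iff, Equiv.refl_apply, (Fin.succ_injective T).swap_apply]⟩

theorem swapKey_injective {N T : ℕ} (hTN : T ≤ N) (m m' : Fin T) :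
    Function.Injective (swapKey (N := N) hTN m m') := fun ζ ζ' h => by
  refine Subtype.ext (funext fun x => ?_)
  exact (Equiv.swap m.succ m'.succ).injective (congrFun (congrArg Subtype.val h) x)

theorem swapKey_ne_zero {N T : ℕ} (hTN : T ≤ N) (m m' : Fin T) (ζ : Key N T) (x : Fin N) :
    (swapKey hTN m m' ζ).1 x ≠ 0 ↔ ζ.1 x ≠ 0 := by
  simp only [swapKey, ne_eq]
  rw [Equiv.swap_apply_eq_iff, Equiv.swap_apply_of_ne_of_ne (Fin.succ_ne_zero _).symm
    (Fin.succ_ne_zero _).symm]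

theorem card_inter_slice_le {N T : ℕ} (hTN : T ≤ N) (A : Finset (Key N T))
    (hA : ∀ m m' ζ, ζ ∈ A → swapKey hTN m m' ζ ∈ A) (x : Fin N) (m m' : Fin T) :
    (A ∩ slice x m).card ≤ (A ∩ slice x m').card := by
  refine Finset.card_le_card_of_injOn (swapKey hTN m m') (fun ζ hζ => ?_)
    (swapKey_injective hTN m m').injOn
  rw [Finset.mem_coe, Finset.mem_inter, mem_slice] at hζ ⊢
  exact ⟨hA _ _ _ hζ.1, by simp [swapKey, hζ.2]⟩

/-- The T slices at x partition A, since x is in the support of all its keys, and message swaps show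
that they are equinumerous. -/
theorem card_inter_slice_mul {N T : ℕ} (hTN : T ≤ N) (A : Finset (Key N T))
    (hA : ∀ m m' ζ, ζ ∈ A → swapKey hTN m m' ζ ∈ A) (x : Fin N) (hx : ∀ ζ ∈ A, ζ.1 x ≠ 0)
    (m : Fin T) : (A ∩ slice x m).card * T = A.card := by
  have h : A = Finset.univ.biUnion fun n : Fin T => A ∩ slice x n := by
    ext ζ
    simp only [Finset.mem_biUnion, Finset.mem_univ, true_and, Finset.mem_inter, mem_slice]
    refine ⟨fun h => ?_, fun ⟨_, h, _⟩ => h⟩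
    obtain ⟨n, hn⟩ := Fin.exists_succ_eq.2 (hx ζ h)
    exact ⟨n, h, hn.symm⟩
  have h2 : A.card = ∑ n : Fin T, (A ∩ slice x n).card := by
    conv_lhs => rw [h]
    refine Finset.card_biUnion fun n _ n' _ hn => Finset.disjoint_left.2 fun ζ h1 h2 => hn ?_
    rw [Finset.mem_inter, mem_slice] at h1 h2
    exact Fin.succ_injective T (h1.2.symm.trans h2.2)
  rw [h2, Finset.sum_congr rfl fun n _ => le_antisymm (card_inter_slice_le hTN A hA x n m)
    (card_inter_slice_le hTN A hA x m n)]
  simp [mul_comm]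

/-- The keys over ω are the T! labellings of its support, and a token of the support carries each
message in a fraction 1/T of them. -/
theorem card_keysOn_inter_slice {N T : ℕ} (hT : 1 ≤ T) (hTN : T ≤ N) {ω : Fin N → Fin 2}
    (hω : ω ∈ hotVectors N T) (x : Fin N) (m : Fin T) :
    (keysOn ω ∩ slice x m).card = if ω x = 0 then 0 else (T - 1)! := by
  split_ifs with hx
  · rw [Finset.card_eq_zero, Finset.eq_empty_iff_forall_notMem]
    intro ζ hζ
    rw [Finset.mem_inter, mem_slice] at hζ
    have := (Finset.mem_filter.1 hζ.1).2 x
    rw [hζ.2] at this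
    exact this.1 (Fin.succ_ne_zero m) hx
  · have h1 := card_inter_slice_mul hTN (keysOn ω) (fun n n' ζ hζ => by
      simp only [keysOn, Finset.mem_filter, Finset.mem_univ, true_and] at hζ ⊢
      intro i
      rw [swapKey_ne_zero, hζ]) x (fun ζ hζ => ((Finset.mem_filter.1 hζ).2 x).2 hx) m
    have hc : (Finset.univ.filter fun i => ω i ≠ 0).card = T := by
      rw [← (Finset.mem_filter.1 hω).2, Finset.card_filter]
      refine Finset.sum_congr rfl fun i _ => ?_
      have : ∀ a : Fin 2, (if a ≠ 0 then 1 else 0) = a.val := by decide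
      exact this _
    have h2 : (keysOn (T := T) ω).card = T ! := by
      have : (Finset.univ : Finset (Fin T ↪ {i // i ∈ Finset.univ.filter fun i => ω i ≠ 0})).card =
          T ! := by
        rw [Finset.card_univ, Fintype.card_embedding_eq, Fintype.card_coe, hc, Fintype.card_fin,
          Nat.descFactorial_self]
      rw [← this]
      symm
      refine Finset.card_bij
        (fun e _ => embeddingKey hTN (e.trans (Function.Embedding.subtype _))) ?_ ?_ ?_
      · intro e _
        simp only [keysOn, Finset.mem_filter, Finset.mem_univ, true_and]
        intro i
        rw [embeddingKey, keyOfEmbedding_ne_zero]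
        constructor
        · rintro ⟨n, rfl⟩
          exact (Finset.mem_filter.1 (e n).2).2
        · intro hi
          have hb : Function.Bijective e := by
            rw [Fintype.bijective_iff_injective_and_card]
            exact ⟨e.injective, by rw [Fintype.card_coe, hc, Fintype.card_fin]⟩
          obtain ⟨n, hn⟩ := hb.2 ⟨i, by simpa using hi⟩
          exact ⟨n, by simp [hn]⟩
      · intro e _ e' _ h
        have := embeddingKey_injective hTN h
        ext n
        exact congrArg Fin.val (congrArg (fun f : Fin T ↪ Fin N => f n) this)
      · intro ζ hζ
        have h3 := (Finset.mem_filter.1 hζ).2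
        have h0 : ζ.1 ≠ 0 := fun h => (h3 x).2 hx (congrFun h x)
        obtain ⟨e, rfl⟩ := exists_embeddingKey hTN ζ h0
        refine ⟨e.codRestrict _ fun n => ?_, Finset.mem_univ _, rfl⟩
        simpa using (h3 (e n)).1 ((keyOfEmbedding_ne_zero e (e n)).2 ⟨n, rfl⟩)
    rw [h2] at h1
    obtain ⟨t, rfl⟩ : ∃ t, T = t + 1 := ⟨T - 1, by omega⟩
    rw [Nat.factorial_succ, mul_comm] at h1
    simpa using h1

theorem mem_anchored {N T : ℕ} {v : Fin N → ℝ} {ζ : Key N T} :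
    ζ ∈ anchored T v ↔ ∀ x, v x ≠ 0 → ζ.1 x ≠ 0 := by
  simp only [anchored, Finset.mem_filter, Finset.mem_univ, true_and]

theorem card_anchored_inter_slice {N T : ℕ} (hTN : T ≤ N) (v : Fin N → ℝ) (x : Fin N)
    (hx : v x ≠ 0) (m : Fin T) :
    (anchored T v ∩ slice x m).card * T = (anchored T v).card := by
  refine card_inter_slice_mul hTN _ (fun n n' ζ hζ => ?_) x (fun ζ hζ => ?_) m
  · rw [mem_anchored] at hζ ⊢
    intro y hy
    exact (swapKey_ne_zero hTN n n' ζ y).2 (hζ y hy)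
  · exact mem_anchored.1 hζ x hx

/-- Enlarge the support of v to T tokens and label them arbitrarily. -/
theorem anchored_nonempty {N T : ℕ} (hTN : T ≤ N) (v : Fin N → ℝ) (hv : numNonzero v ≤ T) :
    (anchored T v).Nonempty := by
  obtain ⟨B, hB, -, hBc⟩ := Finset.exists_subsuperset_card_eq
    (Finset.subset_univ (Finset.univ.filter fun x => v x ≠ 0)) hv (by simpa using hTN)
  have e := B.equivFinOfCardEq hBc
  refine ⟨embeddingKey hTN (e.symm.toEmbedding.trans (Function.Embedding.subtype _)),
    mem_anchored.2 fun x hx => ?_⟩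
  rw [embeddingKey, keyOfEmbedding_ne_zero]
  exact ⟨e ⟨x, hB (by simpa using hx)⟩, by simp⟩

/-! ### The cone of representable vectors -/

open Classical in
/-- The vector with value `1` on `A` and `0` elsewhere. -/
noncomputable def hotVector {N : ℕ} (A : Finset (Fin N)) (i : Fin N) : Fin 2 := if i ∈ A then 1 else 0

theorem hotVector_val {N : ℕ} (A : Finset (Fin N)) (i : Fin N) :
    ((hotVector A i).val : ℝ) = if i ∈ A then 1 else 0 := by
  unfold hotVector
  split_ifs <;> simp

theorem hotVector_mem {N T : ℕ} {A : Finset (Fin N)} (hA : A.card = T) :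
    hotVector A ∈ hotVectors N T := by
  simp only [hotVectors, Finset.mem_filter, Finset.mem_univ, true_and]
  rw [← hA, ← Nat.cast_inj (R := ℝ), Nat.cast_sum, Finset.sum_congr rfl fun i _ => hotVector_val A i]
  simp

theorem sum_val_of_mem_hotVectors {N T : ℕ} {ω : Fin N → Fin 2} (hω : ω ∈ hotVectors N T) :
    ∑ i, ((ω i).val : ℝ) = T := by
  rw [← (Finset.mem_filter.1 hω).2, Nat.cast_sum]

theorem isHotRepresentable_zero {N T : ℕ} : IsHotRepresentable T (0 : Fin N → ℝ) :=
  ⟨0, fun _ _ => le_rfl, fun i => by simp⟩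

theorem IsHotRepresentable.add_hotVector {N T : ℕ} {v : Fin N → ℝ} (hv : IsHotRepresentable T v)
    {A : Finset (Fin N)} (hA : A.card = T) {c : ℝ} (hc : 0 ≤ c) :
    IsHotRepresentable T (fun i => v i + if i ∈ A then c else 0) := by
  obtain ⟨w, hw, hv⟩ := hv
  refine ⟨fun ω => w ω + if ω = hotVector A then c else 0, fun ω hω => ?_, fun i => ?_⟩
  · have := hw ω hω
    dsimp only
    split_ifs <;> linarith
  · simp only [add_mul, Finset.sum_add_distrib, ← hv, ite_mul, zero_mul]
    rw [Finset.sum_ite_eq' , if_pos (hotVector_mem hA), hotVector_val]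
    simp

theorem IsHotRepresentation.sum_eq {N T : ℕ} {v : Fin N → ℝ} {w} (h : IsHotRepresentation T w v) :
    ∑ i, v i = T * ∑ ω ∈ hotVectors N T, w ω := by
  rw [Finset.sum_congr rfl fun i _ => h.2 i, Finset.sum_comm, Finset.mul_sum]
  refine Finset.sum_congr rfl fun ω hω => ?_
  rw [← Finset.mul_sum, sum_val_of_mem_hotVectors hω, mul_comm]

/-- Greedy peeling: subtract a multiple l of the indicator of a T-set A that contains all entries
equal to c and lies in the support. The hypotheses persist with c - l in place of c. With l as large
as possible, some entry of A reaches 0 or some entry outside A reaches the new cap, so the sum of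
the two counts drops. -/
theorem isHotRepresentable_aux {N T : ℕ} (hT : 1 ≤ T) (n : ℕ) : ∀ (v : Fin N → ℝ) (c : ℝ),
    (∀ i, 0 ≤ v i) → (∀ i, v i ≤ c) → ∑ i, v i = T * c →
    (Finset.univ.filter fun i => v i ≠ 0).card + (Finset.univ.filter fun i => v i ≠ c).card ≤ n →
    IsHotRepresentable T v := by
  induction n with
  | zero =>
    intro v c h0 hc hs hn
    have : v = 0 := by
      funext i
      have h1 : (Finset.univ.filter fun i => v i ≠ 0).card = 0 := by omega
      rw [Finset.card_eq_zero, Finset.filter_eq_empty_iff] at h1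
      simpa using h1 (Finset.mem_univ i)
    rw [this]
    exact isHotRepresentable_zero
  | succ n ih =>
    intro v c h0 hc hs hn
    have hTR : (1 : ℝ) ≤ T := by exact_mod_cast hT
    by_cases hv : v = 0
    · rw [hv]; exact isHotRepresentable_zero
    obtain ⟨i₀, hi₀⟩ := Function.ne_iff.1 hv
    have hc0 : 0 < c := lt_of_lt_of_le (lt_of_le_of_ne (h0 i₀) (Ne.symm hi₀)) (hc i₀)
    have h1 : (Finset.univ.filter fun i => v i = c).card ≤ T := by
      have : ∑ i ∈ Finset.univ.filter (fun i => v i = c), v i ≤ ∑ i, v i :=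
        Finset.sum_le_sum_of_subset_of_nonneg (Finset.filter_subset _ _) fun i _ _ => h0 i
      rw [Finset.sum_congr rfl fun i hi => (Finset.mem_filter.1 hi).2, Finset.sum_const, hs,
        nsmul_eq_mul] at this
      exact_mod_cast le_of_mul_le_mul_right this hc0
    have h2 : T ≤ (Finset.univ.filter fun i => v i ≠ 0).card := by
      have : ∑ i, v i ≤ ∑ i ∈ Finset.univ.filter (fun i => v i ≠ 0), c := by
        rw [← Finset.sum_filter_ne_zero]
        exact Finset.sum_le_sum fun i _ => hc i
      rw [Finset.sum_const, hs, nsmul_eq_mul] at this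
      exact_mod_cast le_of_mul_le_mul_right this hc0
    -- From ∑ v = T · c with 0 ≤ v ≤ c, at most T entries equal c and at least T are nonzero, so
    -- such an A exists.
    obtain ⟨A, hA1, hA2, hAc⟩ := Finset.exists_subsuperset_card_eq
      (s := Finset.univ.filter fun i => v i = c) (t := Finset.univ.filter fun i => v i ≠ 0)
      (fun i hi => by
        simp only [Finset.mem_filter, Finset.mem_univ, true_and] at hi ⊢
        rw [hi]; exact hc0.ne') h1 h2
    have hA1' : ∀ i, v i = c → i ∈ A := fun i hi => hA1 (by simpa using hi)
    have hA2' : ∀ i ∈ A, v i ≠ 0 := fun i hi => by simpa using hA2 hi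
    obtain ⟨j, -, hj⟩ := Finset.exists_min_image Finset.univ
      (fun i => if i ∈ A then v i else c - v i) ⟨i₀, Finset.mem_univ _⟩
    set l := if j ∈ A then v j else c - v j with hl
    have hl0 : 0 ≤ l := by
      rw [hl]; split_ifs
      · exact h0 j
      · linarith [hc j]
    have hlA : ∀ i ∈ A, l ≤ v i := fun i hi => by simpa [hi] using hj i (Finset.mem_univ i)
    have hlA' : ∀ i ∉ A, l ≤ c - v i := fun i hi => by simpa [hi] using hj i (Finset.mem_univ i)
    have key : IsHotRepresentable T fun i => v i - if i ∈ A then l else 0 := by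
      refine ih _ (c - l) (fun i => ?_) (fun i => ?_) ?_ ?_
      · split_ifs with hi
        · linarith [hlA i hi]
        · linarith [h0 i]
      · split_ifs with hi
        · linarith [hc i]
        · linarith [hlA' i hi]
      · rw [Finset.sum_sub_distrib, hs, Finset.sum_ite_mem, Finset.univ_inter, Finset.sum_const,
          hAc, nsmul_eq_mul]
        ring
      · have hs1 : (Finset.univ.filter fun i => (v i - if i ∈ A then l else 0) ≠ 0) ⊆
            Finset.univ.filter fun i => v i ≠ 0 := fun i hi => by
          simp only [Finset.mem_filter, Finset.mem_univ, true_and] at hi ⊢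
          by_cases hiA : i ∈ A
          · exact hA2' i hiA
          · simpa [hiA] using hi
        have hs2 : (Finset.univ.filter fun i => (v i - if i ∈ A then l else 0) ≠ c - l) ⊆
            Finset.univ.filter fun i => v i ≠ c := fun i hi => by
          simp only [Finset.mem_filter, Finset.mem_univ, true_and] at hi ⊢
          intro hic
          simp [hic, hA1' i hic] at hi
        by_cases hjA : j ∈ A
        · have : (Finset.univ.filter fun i => (v i - if i ∈ A then l else 0) ≠ 0) ⊂
              Finset.univ.filter fun i => v i ≠ 0 := by
            refine (Finset.ssubset_iff_of_subset hs1).2 ⟨j, hA2 hjA, ?_⟩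
            simp [hjA, hl]
          have := Finset.card_lt_card this
          have := Finset.card_le_card hs2
          omega
        · have : (Finset.univ.filter fun i => (v i - if i ∈ A then l else 0) ≠ c - l) ⊂
              Finset.univ.filter fun i => v i ≠ c := by
            refine (Finset.ssubset_iff_of_subset hs2).2 ⟨j, ?_, ?_⟩
            · simp only [Finset.mem_filter, Finset.mem_univ, true_and]
              exact fun h => hjA (hA1' j h)
            · simp [hjA, hl]
          have := Finset.card_lt_card this
          have := Finset.card_le_card hs1
          omega
    have := key.add_hotVector hAc hl0
    simpa using this

/-- The cone over the hypersimplex. -/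
theorem isHotRepresentable_iff {N T : ℕ} (hT : 1 ≤ T) (v : Fin N → ℝ) :
    IsHotRepresentable T v ↔ (∀ i, 0 ≤ v i) ∧ ∀ i, T * v i ≤ ∑ i, v i := by
  have hTR : (0 : ℝ) < T := by exact_mod_cast hT
  constructor
  · rintro ⟨w, h⟩
    refine ⟨fun i => ?_, fun i => ?_⟩
    · rw [h.2 i]
      exact Finset.sum_nonneg fun ω hω => mul_nonneg (h.1 ω hω) (Nat.cast_nonneg _)
    · rw [h.sum_eq, h.2 i]
      refine mul_le_mul_of_nonneg_left (Finset.sum_le_sum fun ω hω => ?_) hTR.le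
      refine mul_le_of_le_one_right (h.1 ω hω) ?_
      exact_mod_cast Nat.lt_succ_iff.1 (ω i).isLt
  · rintro ⟨h0, h1⟩
    refine isHotRepresentable_aux hT _ v ((∑ i, v i) / T) h0 (fun i => ?_) ?_ le_rfl
    · rw [le_div_iff₀ hTR, mul_comm]
      exact h1 i
    · field_simp

/-! ### Last tokens and one-based entries -/

theorem mem_tail {N j : ℕ} {x : Fin N} : x ∈ tail N j ↔ N ≤ x.val + j := by simp [tail]

/-- An up-closed set of tokens is a final segment, hence determined by its cardinality. -/
theorem mem_tail_card_filter {N : ℕ} (p : Fin N → Prop) [DecidablePred p]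
    (hp : ∀ x y, x ≤ y → p x → p y) (x : Fin N) :
    p x ↔ x ∈ tail N (Finset.univ.filter p).card := by
  rw [mem_tail]
  have hx := x.isLt
  constructor
  · intro h
    have : Finset.Ici x ⊆ Finset.univ.filter p := fun y hy => by
      simpa using hp x y (Finset.mem_Ici.1 hy) h
    have := Finset.card_le_card this
    rw [Fin.card_Ici] at this
    omega
  · intro h
    by_contra hpx
    have : Finset.univ.filter p ⊆ Finset.Ioi x := fun y hy => by
      rw [Finset.mem_Ioi]
      by_contra hxy
      exact hpx (hp y x (not_lt.1 hxy) (by simpa using hy))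
    have := Finset.card_le_card this
    rw [Fin.card_Ioi] at this
    omega

theorem card_tail {N k : ℕ} (hk : k ≤ N) : (tail N k).card = k := by
  rcases Nat.eq_zero_or_pos k with rfl | hk0
  · rw [Finset.card_eq_zero, Finset.eq_empty_iff_forall_notMem]
    intro x hx
    rw [mem_tail] at hx
    omega
  · have : tail N k = Finset.Ici ⟨N - k, by omega⟩ := by
      ext x
      rw [mem_tail, Finset.mem_Ici, Fin.le_def]
      dsimp only
      omega
    rw [this, Fin.card_Ici]
    dsimp only
    omega

theorem entry_val_add_one {N : ℕ} (v : Fin N → ℝ) (x : Fin N) : entry v (x.val + 1) = v x := by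
  unfold entry
  rw [dif_pos ⟨by omega, x.isLt⟩]
  rfl

theorem entry_of_pos {N : ℕ} (v : Fin N → ℝ) {i : ℕ} (h1 : 1 ≤ i) (h2 : i ≤ N) :
    entry v i = v ⟨i - 1, by omega⟩ := by
  unfold entry
  rw [dif_pos ⟨h1, h2⟩]

theorem sum_entry {N : ℕ} (v : Fin N → ℝ) (k : ℕ) :
    ∑ i ∈ Finset.Icc 1 (N - k), entry v i = ∑ x, if x ∈ tail N k then 0 else v x := by
  simp_rw [← ite_not (_ ∈ tail N k)]
  rw [← Finset.sum_filter]
  symm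
  refine Finset.sum_bij (fun x _ => x.val + 1) (fun x hx => ?_) (fun x _ y _ h => ?_)
    (fun i hi => ?_) (fun x _ => (entry_val_add_one v x).symm)
  · simp only [Finset.mem_filter, Finset.mem_univ, true_and, mem_tail] at hx
    rw [Finset.mem_Icc]
    omega
  · exact Fin.ext (by simpa using h)
  · rw [Finset.mem_Icc] at hi
    refine ⟨⟨i - 1, by omega⟩, ?_, by dsimp only; omega⟩
    simp only [Finset.mem_filter, Finset.mem_univ, true_and, mem_tail]
    omega

/-! ### The split -/

theorem capped_le {N : ℕ} (T : ℕ) (α : ℝ) (P : Fin N → ℝ) (x : Fin N) :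
    capped T α P x ≤ α / T := min_le_left _ _

theorem capped_add_part₃ {N : ℕ} (T : ℕ) (α : ℝ) (P : Fin N → ℝ) (x : Fin N) :
    capped T α P x + part₃ T α P x = P x := by
  unfold capped part₃
  rcases le_total (α / T) (P x) with h | h
  · rw [min_eq_left h, max_eq_left (by linarith)]; ring
  · rw [min_eq_right h, max_eq_right (by linarith)]; ring

theorem part₁_add_part₂ {N : ℕ} (T : ℕ) (α : ℝ) (P : Fin N → ℝ) (x : Fin N) :
    part₁ T α P x + part₂ T α P x = capped T α P x := by
  unfold part₂; ring

theorem part₃_nonneg {N : ℕ} (T : ℕ) (α : ℝ) (P : Fin N → ℝ) (x : Fin N) :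
    0 ≤ part₃ T α P x := le_max_right _ _

theorem mem_tail_numLarge {N T : ℕ} {α : ℝ} {P : Fin N → ℝ} (hm : Monotone P) (x : Fin N) :
    α / T ≤ P x ↔ x ∈ tail N (numLarge T α P) :=
  mem_tail_card_filter (fun x => α / T ≤ P x) (fun _ _ h h' => h'.trans (hm h)) x

theorem mem_tail_of_part₃_ne_zero {N T : ℕ} {α : ℝ} {P : Fin N → ℝ} (hm : Monotone P) (x : Fin N)
    (h : part₃ T α P x ≠ 0) : x ∈ tail N (numLarge T α P) := by
  rw [← mem_tail_numLarge hm]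
  by_contra h'
  exact h (max_eq_right (by linarith))

theorem capped_nonneg {N T : ℕ} {α : ℝ} (hα₀ : 0 ≤ α) {P : Fin N → ℝ} (hP : ∀ x, 0 ≤ P x)
    (x : Fin N) : 0 ≤ capped T α P x := le_min (by positivity) (hP x)

/-- The leveling value of a capped vector that is not representable separates its last entries from
the others. -/
theorem levelIndex_spec {N T : ℕ} (hT : 1 ≤ T) (hTN : T ≤ N) {α : ℝ} (hα₀ : 0 ≤ α) (hα₁ : α < 1)
    {P : Fin N → ℝ} (hP : P ∈ stdSimplex ℝ (Fin N)) (hm : Monotone P)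
    (hr : ¬ IsHotRepresentable T (capped T α P)) :
    ∃ k < T, levelIndex T (numLarge T α P) (capped T α P) = k ∧
      (∀ x ∈ tail N k, level T (capped T α P) k < capped T α P x) ∧
      (∀ x ∉ tail N k, capped T α P x ≤ level T (capped T α P) k) ∧
      (∑ x, if x ∈ tail N k then 0 else capped T α P x) = (T - k) * level T (capped T α P) k ∧
      ∑ x, capped T α P x < α := by
  have hTR : (0 : ℝ) < T := by exact_mod_cast hT
  set a := capped T α P with ha
  set K₀ := numLarge T α P with hK₀
  have ham : Monotone a := fun x y h => min_le_min_left _ (hm h)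
  have ha0 : ∀ x, 0 ≤ a x := capped_nonneg hα₀ hP.1
  have hae : ∀ i, 0 ≤ entry a i := fun i => by
    unfold entry; split_ifs
    · exact ha0 _
    · exact le_rfl
  have haα : ∀ x, a x ≤ α / T := capped_le T α P
  have hsum : ∑ x, a x < α := by
    rw [isHotRepresentable_iff hT, not_and] at hr
    have := hr ha0
    push Not at this
    obtain ⟨x, hx⟩ := this
    calc ∑ x, a x < T * a x := hx
      _ ≤ T * (α / T) := mul_le_mul_of_nonneg_left (haα x) hTR.le
      _ = α := by field_simp
  have hlarge : ∀ x ∈ tail N K₀, a x = α / T := fun x hx =>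
    min_eq_left ((mem_tail_numLarge hm x).2 hx)
  -- Otherwise T entries equal to α / T would already sum to α.
  have hKT : K₀ < T := by
    by_contra h
    push Not at h
    have h1 : ∑ x ∈ tail N T, a x ≤ ∑ x, a x :=
      Finset.sum_le_sum_of_subset_of_nonneg (Finset.subset_univ _) fun i _ _ => ha0 i
    rw [Finset.sum_congr rfl fun x hx => hlarge x (by rw [mem_tail] at hx ⊢; omega),
      Finset.sum_const, card_tail hTN, nsmul_eq_mul, mul_div_cancel₀ _ hTR.ne'] at h1
    linarith
  -- If nothing is capped then a = P sums to 1 > α. The bound 1 ≤ K₀ makes N - k + 1 a genuine index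
  -- below.
  have hK1 : 1 ≤ K₀ := by
    by_contra h
    have h0 : K₀ = 0 := by omega
    have : ∀ x, a x = P x := fun x => by
      refine min_eq_right (le_of_lt (not_le.1 fun hx => ?_))
      rw [mem_tail_numLarge hm, ← hK₀, h0, mem_tail] at hx
      omega
    rw [Finset.sum_congr rfl fun x _ => this x, hP.2] at hsum
    linarith
  have hne : {k | K₀ ≤ k ∧ k < T ∧ entry a (N - k) ≤ level T a k}.Nonempty := by
    -- At k = T - 1 the denominator is 1, and a sum of non-negative entries dominates its last term.
    refine ⟨T - 1, by omega, by omega, ?_⟩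
    have : (T : ℝ) - (T - 1 : ℕ) = 1 := by
      rw [Nat.cast_sub hT]; simp
    rw [level, this, div_one]
    exact Finset.single_le_sum (f := entry a) (fun i _ => hae i)
      (Finset.mem_Icc.2 ⟨by omega, le_rfl⟩)
  obtain ⟨k, hk⟩ : ∃ k, levelIndex T K₀ a = k := ⟨_, rfl⟩
  obtain ⟨h1, h2, h3⟩ : K₀ ≤ k ∧ k < T ∧ entry a (N - k) ≤ level T a k := by
    have := Nat.sInf_mem hne
    rw [levelIndex] at hk
    rw [hk] at this
    exact this
  have hkR : (0 : ℝ) < T - k := sub_pos.2 (by exact_mod_cast h2)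
  have hlev : level T a k < entry a (N - k + 1) := by
    rw [level, div_lt_iff₀ hkR]
    -- If k = K₀, the entry is α / T and ∑ a < α decides. If k > K₀, minimality makes k - 1 fail;
    -- splitting the top entry off the sum in that failed inequality leaves the claim for k.
    rcases h1.eq_or_lt with h | h
    · have h5 : ∀ x, a x = (if x ∈ tail N k then α / T else 0) + if x ∈ tail N k then 0 else a x :=
        fun x => by
          split_ifs with hx
          · rw [hlarge x (h ▸ hx)]; ring
          · ring
      have h4 : ∑ x, a x = k * (α / T) + ∑ i ∈ Finset.Icc 1 (N - k), entry a i := by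
        rw [sum_entry, Finset.sum_congr rfl fun x _ => h5 x, Finset.sum_add_distrib,
          Finset.sum_ite_mem, Finset.univ_inter, Finset.sum_const, card_tail (by omega),
          nsmul_eq_mul]
      rw [entry_of_pos a (by omega) (by omega), hlarge _ (by rw [mem_tail]; dsimp only; omega)]
      have : (α / T) * (T - k) = α - k * (α / T) := by field_simp
      linarith
    · have h4 : k - 1 ∉ {k | K₀ ≤ k ∧ k < T ∧ entry a (N - k) ≤ level T a k} :=
        Nat.notMem_of_lt_sInf (by rw [← levelIndex, hk]; omega)
      simp only [Set.mem_ofPred_eq, not_and, not_le] at h4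
      have h5 := h4 (by omega) (by omega)
      have h6 : N - (k - 1) = N - k + 1 := by omega
      have h7 : ((k - 1 : ℕ) : ℝ) = k - 1 := by
        rw [Nat.cast_sub (by omega)]; simp
      rw [level, h6, h7, div_lt_iff₀ (by linarith),
        Finset.sum_Icc_succ_top (by omega)] at h5
      linarith
  refine ⟨k, h2, hk, fun x hx => ?_, fun x hx => ?_, ?_, hsum⟩
  · refine hlev.trans_le ?_
    rw [entry_of_pos a (by omega) (by omega)]
    refine ham ?_
    rw [mem_tail] at hx
    rw [Fin.le_def]
    dsimp only
    omega
  · refine le_trans ?_ h3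
    rw [entry_of_pos a (by omega) (by omega)]
    refine ham ?_
    rw [mem_tail] at hx
    rw [Fin.le_def]
    dsimp only
    omega
  · rw [← sum_entry, level]
    field_simp

/-- The properties of the split of a non-decreasing token distribution. -/
structure SplitSpec {N : ℕ} (T : ℕ) (α : ℝ) (P : Fin N → ℝ) : Prop where
  representable : IsHotRepresentable T (part₁ T α P)
  nonneg : ∀ x, 0 ≤ part₂ T α P x
  mono : Monotone (part₂ T α P)
  numNonzero_lt : numNonzero (part₂ T α P) < T
  ne_zero_iff : ∀ x, part₂ T α P x ≠ 0 ↔ x ∈ tail N (numNonzero (part₂ T α P))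
  add_le : ∀ x y, part₁ T α P x + part₂ T α P y ≤ α / T
  eq_zero : ∑ x, part₃ T α P x = 0 → part₂ T α P = 0
  imbalance_le : ∀ x, T * part₂ T α P x - ∑ y, part₂ T α P y ≤ ∑ y, part₃ T α P y

theorem numNonzero_zero {N : ℕ} : numNonzero (0 : Fin N → ℝ) = 0 := by simp [numNonzero]

/-- With y the leveling value, `part₁` sums to T · y and is at most y, hence is representable, while
`part₂` is at most α / T - y. Adding these bounds gives `add_le`, used for the α-bounded total sum.
Summing gives a deficit of at most α - ∑ a ≤ 1 - ∑ a = ∑ `part₃`, which is `imbalance_le`. Since ∑ a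
< 1 here, `part₃` can vanish only in the representable case, where `part₂` is zero. -/
theorem splitSpec {N T : ℕ} (hT : 1 ≤ T) (hTN : T ≤ N) {α : ℝ} (hα₀ : 0 ≤ α) (hα₁ : α < 1)
    {P : Fin N → ℝ} (hP : P ∈ stdSimplex ℝ (Fin N)) (hm : Monotone P) : SplitSpec T α P := by
  have hTR : (0 : ℝ) < T := by exact_mod_cast hT
  by_cases hr : IsHotRepresentable T (capped T α P)
  · have h1 : part₁ T α P = capped T α P := by
      funext x; simp [part₁, hr]
    have h2 : part₂ T α P = 0 := by
      funext x; simp [part₂, h1]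
    refine ⟨by rwa [h1], ?_, ?_, ?_, ?_, ?_, fun _ => h2, ?_⟩ <;> simp only [h2, h1, numNonzero_zero]
    · exact fun _ => le_rfl
    · exact monotone_const
    · omega
    · intro x; simp [mem_tail]
    · intro x y; simpa using capped_le T α P x
    · intro x
      simpa using Finset.sum_nonneg fun x _ => part₃_nonneg T α P x
  · obtain ⟨k, hkT, hk, hlt, hle, hs, hsum⟩ := levelIndex_spec hT hTN hα₀ hα₁ hP hm hr
    set y := level T (capped T α P) k with hy
    have h1 : ∀ x, part₁ T α P x = if x ∈ tail N k then y else capped T α P x := fun x => by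
      simp only [part₁, hr, hk, if_false, ← hy]
    have h2 : ∀ x, part₂ T α P x = if x ∈ tail N k then capped T α P x - y else 0 := fun x => by
      rw [part₂, h1]
      split_ifs <;> ring
    have ham : Monotone (capped T α P) := fun x y h => min_le_min_left _ (hm h)
    have ha0 := capped_nonneg (T := T) hα₀ hP.1
    have hkR : (0 : ℝ) < T - k := sub_pos.2 (by exact_mod_cast hkT)
    have hy0 : 0 ≤ y := by
      have : 0 ≤ (T - k) * y := by
        rw [← hs]
        refine Finset.sum_nonneg fun x _ => ?_
        split_ifs
        · exact le_rfl
        · exact ha0 x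
      exact nonneg_of_mul_nonneg_right this hkR
    have hS1 : ∑ x, part₁ T α P x = T * y := by
      have : ∀ x, part₁ T α P x = (if x ∈ tail N k then y else 0) +
          if x ∈ tail N k then 0 else capped T α P x := fun x => by
        rw [h1]; split_ifs <;> ring
      rw [Finset.sum_congr rfl fun x _ => this x, Finset.sum_add_distrib, hs, Finset.sum_ite_mem,
        Finset.univ_inter, Finset.sum_const, card_tail (by omega), nsmul_eq_mul]
      ring
    have h1y : ∀ x, part₁ T α P x ≤ y := fun x => by
      rw [h1]
      split_ifs with hx
      · exact le_rfl
      · exact hle x hx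
    have hne : ∀ x, part₂ T α P x ≠ 0 ↔ x ∈ tail N k := fun x => by
      rw [h2]
      split_ifs with hx
      · exact iff_of_true (sub_pos.2 (hlt x hx)).ne' hx
      · exact iff_of_false (fun h => h rfl) hx
    have hnum : numNonzero (part₂ T α P) = k := by
      rw [← card_tail (N := N) (k := k) (by omega), numNonzero]
      congr 1
      ext x
      simp [hne]
    have hnn : ∀ x, 0 ≤ part₂ T α P x := fun x => by
      rw [h2]
      split_ifs with hx
      · exact (sub_pos.2 (hlt x hx)).le
      · exact le_rfl
    have hle2 : ∀ x, part₂ T α P x ≤ α / T - y := fun x => by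
      have h0 := capped_le T α P x
      rw [h2]
      split_ifs with hx
      · linarith
      -- Off the tail the claim is y ≤ α / T. Were y above every capped entry, the tail would be
      -- empty and the capped vector would equal the representable `part₁`.
      · obtain ⟨z, hz⟩ : ∃ z, y ≤ capped T α P z := by
          by_contra! h
          apply hr
          have : ∀ z, z ∉ tail N k := fun z hz => (hlt z hz).not_ge (h z).le
          have h3 : part₁ T α P = capped T α P := by
            funext z; rw [h1, if_neg (this z)]
          rw [← h3, isHotRepresentable_iff hT, hS1]
          refine ⟨fun i => by rw [h3]; exact ha0 i, fun i => ?_⟩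
          exact mul_le_mul_of_nonneg_left (h1y i) hTR.le
        linarith [capped_le T α P z]
    have hS3 : ∑ x, capped T α P x + ∑ x, part₃ T α P x = 1 := by
      rw [← Finset.sum_add_distrib, Finset.sum_congr rfl fun x _ => capped_add_part₃ T α P x, hP.2]
    refine ⟨?_, hnn, fun x z hxz => ?_, by omega, by rwa [hnum], fun x z => ?_, fun h => ?_,
      fun x => ?_⟩
    · rw [isHotRepresentable_iff hT, hS1]
      refine ⟨fun x => ?_, fun i => mul_le_mul_of_nonneg_left (h1y i) hTR.le⟩
      rw [h1]
      split_ifs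
      · exact hy0
      · exact ha0 x
    · by_cases hx : x ∈ tail N k
      · have hz : z ∈ tail N k := by
          rw [mem_tail] at hx ⊢
          rw [Fin.le_def] at hxz
          omega
        rw [h2, h2, if_pos hx, if_pos hz]
        linarith [ham hxz]
      · rw [h2, if_neg hx]
        exact hnn z
    · linarith [h1y x, hle2 z]
    · rw [h] at hS3
      linarith
    · have hS2 : ∑ x, part₁ T α P x + ∑ x, part₂ T α P x = ∑ x, capped T α P x := by
        rw [← Finset.sum_add_distrib, Finset.sum_congr rfl fun x _ => part₁_add_part₂ T α P x]
      have h3 := mul_le_mul_of_nonneg_left (hle2 x) hTR.le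
      rw [mul_sub, mul_div_cancel₀ _ hTR.ne'] at h3
      linarith

theorem sum_ite_mem_slice {N T : ℕ} (hTN : T ≤ N) (ζ : Key N T) (hζ : ζ.1 ≠ 0) (m : Fin T) :
    ∃ x₀, (∀ y, ζ ∈ slice y m ↔ y = x₀) ∧
      ∀ f : Fin N → ℝ, ∑ x, (if ζ ∈ slice x m then f x else 0) = f x₀ := by
  obtain ⟨x₀, h⟩ := exists_mem_slice hTN ζ hζ m
  exact ⟨x₀, h, fun f => by simp only [h, Finset.sum_ite_eq', Finset.mem_univ, if_true]⟩

/-! ### The first table -/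

/-- The weight that the first table gives to a key. -/
noncomputable def hotWeight {N T : ℕ} (w : (Fin N → Fin 2) → ℝ) (ζ : Key N T) : ℝ :=
  ∑ ω ∈ hotVectors N T, if ζ ∈ keysOn ω then w ω / ((T - 1)! : ℕ) else 0

theorem table₁_eq {N T : ℕ} (w : (Fin N → Fin 2) → ℝ) (m : Fin T) (x : Fin N) (ζ : Key N T) :
    table₁ w m x ζ = if ζ ∈ slice x m then hotWeight w ζ else 0 := by
  unfold table₁ hotWeight
  split_ifs with h <;> simp [h]

theorem hotWeight_nonneg {N T : ℕ} {w : (Fin N → Fin 2) → ℝ} {v : Fin N → ℝ}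
    (hw : IsHotRepresentation T w v) (ζ : Key N T) : 0 ≤ hotWeight w ζ := by
  refine Finset.sum_nonneg fun ω hω => ?_
  split_ifs
  · exact div_nonneg (hw.1 ω hω) (Nat.cast_nonneg _)
  · exact le_rfl

theorem sum_table₁ {N T : ℕ} (hT : 1 ≤ T) (hTN : T ≤ N) {w : (Fin N → Fin 2) → ℝ} {v : Fin N → ℝ}
    (hw : IsHotRepresentation T w v) (m : Fin T) (x : Fin N) : ∑ ζ, table₁ w m x ζ = v x := by
  unfold table₁
  rw [Finset.sum_comm, hw.2 x]
  refine Finset.sum_congr rfl fun ω hω => ?_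
  simp_rw [← Finset.mem_inter]
  rw [Finset.sum_ite_mem, Finset.univ_inter, Finset.sum_const, nsmul_eq_mul,
    card_keysOn_inter_slice hT hTN hω]
  have hf : ((T - 1)! : ℝ) ≠ 0 := by exact_mod_cast Nat.factorial_ne_zero _
  have : ∀ a : Fin 2, a ≠ 0 → a.val = 1 := by decide
  split_ifs with h
  · simp [h]
  · rw [this _ h]
    field_simp
    simp

/-! ### Nondecreasing vectors supported on few last entries -/

/-- A non-negative and non-decreasing vector with fewer than `T` nonzero entries, which are its last
ones. -/
structure IsStaircase {N : ℕ} (T : ℕ) (v : Fin N → ℝ) : Prop where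
  nonneg : ∀ x, 0 ≤ v x
  mono : Monotone v
  numNonzero_lt : numNonzero v < T
  ne_zero_iff : ∀ x, v x ≠ 0 ↔ x ∈ tail N (numNonzero v)

theorem SplitSpec.isStaircase {N T : ℕ} {α : ℝ} {P : Fin N → ℝ} (h : SplitSpec T α P) :
    IsStaircase T (part₂ T α P) := ⟨h.nonneg, h.mono, h.numNonzero_lt, h.ne_zero_iff⟩

/-- Telescoping: the layers containing x are those from the first tail that reaches x onwards. -/
theorem sum_increment_aux {N : ℕ} (v : Fin N → ℝ) (x : Fin N) (n : ℕ) (hn : n ≤ N) :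
    ∑ j ∈ Finset.Icc 1 n, (if x ∈ tail N j then increment v j else 0) =
      if x ∈ tail N n then v x - entry v (N - n) else 0 := by
  induction n with
  | zero => simp [mem_tail]
  | succ n ih =>
    rw [Finset.sum_Icc_succ_top (by omega), ih (by omega), increment]
    have h1 : N - (n + 1) + 1 = N - n := by omega
    rw [h1]
    by_cases hx : x ∈ tail N n
    · have hx' : x ∈ tail N (n + 1) := by rw [mem_tail] at hx ⊢; omega
      rw [if_pos hx, if_pos hx', if_pos hx']
      ring
    · rw [if_neg hx]
      split_ifs with hx'
      · have : N - n = x.val + 1 := by rw [mem_tail] at hx hx'; omega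
        rw [this, entry_val_add_one]
        ring
      · simp

theorem IsStaircase.sum_increment_ite {N T : ℕ} (hTN : T ≤ N) {v : Fin N → ℝ}
    (hv : IsStaircase T v) (x : Fin N) :
    ∑ j ∈ Finset.Icc 1 (numNonzero v), (if x ∈ tail N j then increment v j else 0) = v x := by
  have hK := hv.numNonzero_lt
  rw [sum_increment_aux v x _ (by omega)]
  split_ifs with h
  -- As `numNonzero v` < T ≤ N, this is the genuine entry just before the support, not the default
  -- value.
  · have : entry v (N - numNonzero v) = 0 := by
      rw [entry_of_pos v (by omega) (by omega)]
      by_contra h0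
      rw [← ne_eq, hv.ne_zero_iff, mem_tail] at h0
      dsimp only at h0
      omega
    rw [this, sub_zero]
  · by_contra h0
    exact h ((hv.ne_zero_iff x).1 (Ne.symm h0))

theorem entry_last {N : ℕ} (v : Fin N → ℝ) (hN : 1 ≤ N) : entry v N = v ⟨N - 1, by omega⟩ :=
  entry_of_pos v hN le_rfl

theorem IsStaircase.le_entry_last {N T : ℕ} {v : Fin N → ℝ} (hv : IsStaircase T v) (x : Fin N) :
    v x ≤ entry v N := by
  have := x.isLt
  rw [entry_last v (by omega)]
  refine hv.mono ?_
  rw [Fin.le_def]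
  dsimp only
  omega

theorem IsStaircase.sum_increment {N T : ℕ} (hTN : T ≤ N) {v : Fin N → ℝ} (hv : IsStaircase T v) :
    ∑ j ∈ Finset.Icc 1 (numNonzero v), increment v j = entry v N := by
  have hK := hv.numNonzero_lt
  rw [entry_last v (by omega), ← hv.sum_increment_ite hTN]
  refine Finset.sum_congr rfl fun j hj => ?_
  rw [Finset.mem_Icc] at hj
  rw [if_pos]
  rw [mem_tail]
  dsimp only
  omega

/-! ### The second table -/

/-- Inverse of the number of anchored keys that decode a given token of the support of `v` to a
given message. -/
noncomputable def anchorWeight {N : ℕ} (T : ℕ) (v : Fin N → ℝ) : ℝ :=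
  T / ((anchored (N := N) T v).card : ℝ)

theorem IsStaircase.card_anchored_pos {N T : ℕ} (hTN : T ≤ N) {v : Fin N → ℝ}
    (hv : IsStaircase T v) : (0 : ℝ) < (anchored (N := N) T v).card := by
  exact_mod_cast (anchored_nonempty hTN v hv.numNonzero_lt.le).card_pos

theorem anchorWeight_nonneg {N T : ℕ} (v : Fin N → ℝ) : 0 ≤ anchorWeight T v := by
  unfold anchorWeight; positivity

/-- For x in the support, the slice size |S| / T depends neither on x nor on m, so it factors out of
the layers and the increments telescope to v x. -/
theorem IsStaircase.table₂_eq {N T : ℕ} (hTN : T ≤ N) {v : Fin N → ℝ} (hv : IsStaircase T v)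
    (m : Fin T) (x : Fin N) (ζ : Key N T) :
    table₂ v m x ζ =
      if ζ ∈ slice x m then (if ζ ∈ anchored T v then v x * anchorWeight T v else 0) else 0 := by
  have hT : 1 ≤ T := by have := hv.numNonzero_lt; omega
  by_cases h : ζ ∈ anchored T v ∩ slice x m
  · have h' := Finset.mem_inter.1 h
    rw [if_pos h'.2, if_pos h'.1, table₂]
    simp only [h, and_true]
    by_cases hx : v x = 0
    · rw [hx, zero_mul]
      refine Finset.sum_eq_zero fun j hj => if_neg fun hxj => ?_
      refine absurd hx ((hv.ne_zero_iff x).2 ?_)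
      rw [Finset.mem_Icc] at hj
      rw [mem_tail] at hxj ⊢
      omega
    · have hc : (((anchored T v ∩ slice x m).card : ℕ) : ℝ) * T = (anchored (N := N) T v).card := by
        exact_mod_cast card_anchored_inter_slice hTN v x hx m
      have hp := hv.card_anchored_pos hTN
      have hTR : (0 : ℝ) < T := by exact_mod_cast hT
      have hq : (((anchored T v ∩ slice x m).card : ℕ) : ℝ) ≠ 0 := fun h0 => by
        rw [h0, zero_mul] at hc; linarith
      have : anchorWeight T v = (((anchored T v ∩ slice x m).card : ℕ) : ℝ)⁻¹ := by
        rw [anchorWeight, ← hc]; field_simp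
      rw [this]
      conv_rhs => rw [← hv.sum_increment_ite hTN, Finset.sum_mul]
      refine Finset.sum_congr rfl fun j _ => ?_
      rw [ite_mul, zero_mul, div_eq_mul_inv]
  · have h2 : table₂ v m x ζ = 0 :=
      Finset.sum_eq_zero fun j _ => if_neg fun h0 => h h0.2
    rw [h2]
    rw [Finset.mem_inter, not_and] at h
    split_ifs with h3 h4
    · exact absurd h3 (h h4)
    · rfl
    · rfl

theorem IsStaircase.table₂_nonneg {N T : ℕ} (hTN : T ≤ N) {v : Fin N → ℝ} (hv : IsStaircase T v)
    (m : Fin T) (x : Fin N) (ζ : Key N T) : 0 ≤ table₂ v m x ζ := by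
  rw [hv.table₂_eq hTN]
  split_ifs
  · exact mul_nonneg (hv.nonneg x) (anchorWeight_nonneg v)
  · exact le_rfl
  · exact le_rfl

theorem IsStaircase.sum_table₂ {N T : ℕ} (hTN : T ≤ N) {v : Fin N → ℝ} (hv : IsStaircase T v)
    (m : Fin T) (x : Fin N) : ∑ ζ, table₂ v m x ζ = v x := by
  have hT : 1 ≤ T := by have := hv.numNonzero_lt; omega
  simp only [hv.table₂_eq hTN, ← ite_and, and_comm (a := _ ∈ slice x m)]
  simp_rw [← Finset.mem_inter]
  rw [Finset.sum_ite_mem, Finset.univ_inter, Finset.sum_const, nsmul_eq_mul]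
  by_cases hx : v x = 0
  · simp [hx]
  · have hc : (((anchored T v ∩ slice x m).card : ℕ) : ℝ) * T = (anchored (N := N) T v).card := by
      exact_mod_cast card_anchored_inter_slice hTN v x hx m
    have hp := (hv.card_anchored_pos hTN).ne'
    rw [anchorWeight]
    field_simp
    linear_combination hc

/-- The row sum to which the third table completes the second one. -/
noncomputable def anchorSum {N T : ℕ} (v : Fin N → ℝ) (ζ : Key N T) : ℝ :=
  if ζ ∈ anchored T v then entry v N * anchorWeight T v else 0

theorem sum_table₂_of_eq_zero {N T : ℕ} {v : Fin N → ℝ} (hTN : T ≤ N) (hv : IsStaircase T v)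
    {ζ : Key N T} (hζ : ζ.1 = 0) (m : Fin T) : ∑ x, table₂ v m x ζ = 0 := by
  refine Finset.sum_eq_zero fun x _ => ?_
  rw [hv.table₂_eq hTN, if_neg fun h => ne_zero_of_mem_slice h hζ]

theorem anchorSum_of_eq_zero {N T : ℕ} {v : Fin N → ℝ} (hT : 1 ≤ T) (hTN : T ≤ N)
    {ζ : Key N T} (hζ : ζ.1 = 0) : anchorSum v ζ = 0 := by
  unfold anchorSum
  split_ifs with h
  · rw [entry_last v (by omega)]
    by_contra h0
    exact mem_anchored.1 h _ (left_ne_zero_of_mul h0) (congrFun hζ _)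
  · rfl

/-- The row sum of μ is proportional to v at the token carrying μ. Monotonicity bounds it by the
value at the last token, attained by the message there; if v is zero at the last token,
non-negativity suffices. -/
theorem IsStaircase.iSup_sum_table₂ {N T : ℕ} (hTN : T ≤ N) {v : Fin N → ℝ}
    (hv : IsStaircase T v) (ζ : Key N T) :
    ⨆ μ : Fin T, ∑ x, table₂ v μ x ζ = anchorSum v ζ := by
  have hT : 1 ≤ T := by have := hv.numNonzero_lt; omega
  have : Nonempty (Fin T) := ⟨⟨0, hT⟩⟩
  by_cases hζ : ζ.1 = 0
  · simp only [sum_table₂_of_eq_zero hTN hv hζ, ciSup_const, anchorSum_of_eq_zero hT hTN hζ]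
  · have hτ := anchorWeight_nonneg (T := T) v
    unfold anchorSum
    have hrow : ∀ μ, ∃ x₀, (∀ y, ζ ∈ slice y μ ↔ y = x₀) ∧ ∑ x, table₂ v μ x ζ =
        if ζ ∈ anchored T v then v x₀ * anchorWeight T v else 0 := fun μ => by
      obtain ⟨x₀, h, hs⟩ := sum_ite_mem_slice hTN ζ hζ μ
      refine ⟨x₀, h, ?_⟩
      simp only [hv.table₂_eq hTN, hs]
    refine le_antisymm (ciSup_le fun μ => ?_) ?_
    · obtain ⟨x₀, -, h⟩ := hrow μ
      rw [h]
      split_ifs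
      · exact mul_le_mul_of_nonneg_right (hv.le_entry_last x₀) hτ
      · exact le_rfl
    · have hex : ∃ μ : Fin T, (if ζ ∈ anchored T v then entry v N * anchorWeight T v else 0) ≤
          ∑ x, table₂ v μ x ζ := by
        split_ifs with hA
        · rw [entry_last v (by omega)]
          by_cases h0 : v ⟨N - 1, by omega⟩ = 0
          · refine ⟨⟨0, hT⟩, ?_⟩
            rw [h0, zero_mul]
            exact Finset.sum_nonneg fun x _ => hv.table₂_nonneg hTN _ _ _
          · obtain ⟨μ, hμ⟩ := Fin.exists_succ_eq.2 (mem_anchored.1 hA _ h0)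
            obtain ⟨x₀, hx₀, h⟩ := hrow μ
            refine ⟨μ, ?_⟩
            rw [h, if_pos hA, (hx₀ _).1 (mem_slice.2 hμ.symm)]
        · exact ⟨⟨0, hT⟩, Finset.sum_nonneg fun x _ => hv.table₂_nonneg hTN _ _ _⟩
      obtain ⟨μ, hμ⟩ := hex
      exact le_ciSup_of_le (Set.finite_range _).bddAbove μ hμ

theorem IsStaircase.imbalance_eq {N T : ℕ} (hTN : T ≤ N) {v : Fin N → ℝ} (hv : IsStaircase T v)
    (m : Fin T) (ζ : Key N T) :
    imbalance (table₂ v) m ζ = anchorSum v ζ - ∑ x, table₂ v m x ζ := by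
  rw [imbalance, hv.iSup_sum_table₂ hTN]

theorem imbalance_nonneg {N T : ℕ} (Q : Fin T → Fin N → Key N T → ℝ) (m : Fin T) (ζ : Key N T) :
    0 ≤ imbalance Q m ζ :=
  sub_nonneg.2 (le_ciSup (f := fun μ => ∑ x, Q μ x ζ) (Set.finite_range _).bddAbove m)

theorem IsStaircase.imbalance_of_eq_zero {N T : ℕ} (hTN : T ≤ N) {v : Fin N → ℝ}
    (hv : IsStaircase T v) (m : Fin T) {ζ : Key N T} (hζ : ζ.1 = 0) :
    imbalance (table₂ v) m ζ = 0 := by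
  have hT : 1 ≤ T := by have := hv.numNonzero_lt; omega
  rw [hv.imbalance_eq hTN, sum_table₂_of_eq_zero hTN hv hζ, anchorSum_of_eq_zero hT hTN hζ, sub_zero]

/-- `anchorSum` takes the value v(N) · T / |S| on the |S| anchored keys, and the second table has
total mass ∑ v. -/
theorem IsStaircase.totalImbalance_eq {N T : ℕ} (hTN : T ≤ N) {v : Fin N → ℝ}
    (hv : IsStaircase T v) (m : Fin T) :
    totalImbalance (table₂ v) m = T * entry v N - ∑ x, v x := by
  have hp := (hv.card_anchored_pos hTN).ne'
  unfold totalImbalance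
  simp only [hv.imbalance_eq hTN, Finset.sum_sub_distrib]
  rw [Finset.sum_comm]
  simp only [hv.sum_table₂ hTN]
  congr 1
  unfold anchorSum anchorWeight
  rw [Finset.sum_ite_mem, Finset.univ_inter, Finset.sum_const, nsmul_eq_mul]
  field_simp

/-! ### The third table -/

/-- The slices of the last j tokens are disjoint, because m sits on one token only, and each takes
|S| / T anchored keys. -/
theorem IsStaircase.card_missing {N T : ℕ} (hTN : T ≤ N) {v : Fin N → ℝ} (hv : IsStaircase T v)
    (m : Fin T) {j : ℕ} (hj : j ≤ numNonzero v) :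
    ((missing v m j).card : ℝ) * T = (anchored (N := N) T v).card * (T - j) := by
  have hK := hv.numNonzero_lt
  have h1 := Finset.card_sdiff_add_card_inter (anchored T v)
    ((tail N j).biUnion fun l => slice l m)
  rw [Finset.inter_biUnion, Finset.card_biUnion] at h1
  · have h2 : (∑ l ∈ tail N j, (anchored T v ∩ slice l m).card) * T =
        j * (anchored (N := N) T v).card := by
      rw [Finset.sum_mul, Finset.sum_congr rfl fun l hl =>
        card_anchored_inter_slice hTN v l ((hv.ne_zero_iff l).2 ?_) m, Finset.sum_const,
        card_tail (by omega), smul_eq_mul]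
      rw [mem_tail] at hl ⊢
      omega
    rw [← missing] at h1
    have h1' : ((missing v m j).card : ℝ) + (∑ l ∈ tail N j, (anchored T v ∩ slice l m).card : ℕ) =
      (anchored (N := N) T v).card := by exact_mod_cast h1
    have h2' : ((∑ l ∈ tail N j, (anchored T v ∩ slice l m).card : ℕ) : ℝ) * T =
        j * (anchored (N := N) T v).card := by exact_mod_cast h2
    linear_combination T * h1' - h2'
  · intro l _ l' _ hne
    refine Finset.disjoint_left.2 fun ζ h h' => hne ?_
    rw [Finset.mem_inter] at h h'
    obtain ⟨x₀, hx₀⟩ := exists_mem_slice hTN ζ (ne_zero_of_mem_slice h.2) m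
    rw [hx₀] at h h'
    rw [h.2, h'.2]

/-- By `card_missing`, each layer weight becomes the increment times T / |S|. The layers not
reaching the token x₀ that carries m add up to v(N) - v(x₀), exactly the deficit of m at ζ. -/
theorem IsStaircase.table₃_eq {N T : ℕ} (hTN : T ≤ N) {v : Fin N → ℝ} (hv : IsStaircase T v)
    {r : Fin N → ℝ} {K₀ : ℕ} (hr : ∀ x, r x ≠ 0 → x ∈ tail N K₀) (U : ℝ) (m : Fin T) (x : Fin N)
    {ζ : Key N T} (hζ : ζ.1 ≠ 0) :
    table₃ v r K₀ U m x ζ = imbalance (table₂ v) m ζ * (r x / ∑ i, r i) := by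
  rw [table₃, if_neg hζ]
  by_cases hx : r x = 0
  · simp [hx]
  have hK := hv.numNonzero_lt
  have hp := hv.card_anchored_pos hTN
  have hTR : (0 : ℝ) < T := by exact_mod_cast (by omega : 0 < T)
  obtain ⟨x₀, h, hs⟩ := sum_ite_mem_slice hTN ζ hζ m
  have hmiss : ∀ j, ζ ∈ missing v m j ↔ ζ ∈ anchored T v ∧ x₀ ∉ tail N j := fun j => by
    simp only [missing, Finset.mem_sdiff, Finset.mem_biUnion, h]
    simp
  rw [hv.imbalance_eq hTN, anchorSum]
  simp only [hv.table₂_eq hTN, hs, hr x hx, true_and, hmiss]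
  by_cases hA : ζ ∈ anchored T v
  · simp only [hA, true_and, if_true]
    rw [← sub_mul, ← hv.sum_increment_ite hTN x₀, ← hv.sum_increment hTN,
      ← Finset.sum_sub_distrib, Finset.sum_mul, Finset.sum_mul]
    refine Finset.sum_congr rfl fun j hj => ?_
    rw [Finset.mem_Icc] at hj
    by_cases hj0 : x₀ ∈ tail N j
    · simp [hj0]
    · simp only [hj0, not_false_eq_true, if_true, if_false, sub_zero]
      congr 1
      have hc := hv.card_missing hTN m hj.2
      have hjT : (0 : ℝ) < T - j := sub_pos.2 (by exact_mod_cast (by omega : j < T))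
      have hm0 : ((missing v m j).card : ℝ) ≠ 0 := fun h0 => by
        rw [h0, zero_mul] at hc
        exact (mul_pos hp hjT).ne hc
      rw [anchorWeight, mul_div_assoc]
      congr 1
      rw [div_eq_div_iff hm0 hp.ne']
      linear_combination -hc
  · simp [hA]

/-- The nonzero keys take U · r x / ∑ r from column x, and the zero key is given the remainder. -/
theorem IsStaircase.sum_table₃ {N T : ℕ} (hTN : T ≤ N) {v : Fin N → ℝ} (hv : IsStaircase T v)
    {r : Fin N → ℝ} {K₀ : ℕ} (hr : ∀ x, r x ≠ 0 → x ∈ tail N K₀) (m : Fin T) (x : Fin N) :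
    ∑ ζ, table₃ v r K₀ (totalImbalance (T := T) (table₂ v) m) m x ζ = r x := by
  set U := totalImbalance (T := T) (table₂ v) m with hU
  have h0 : (0 : Fin N → Fin (T + 1)) ∈ reducedKeySet N T := Finset.mem_insert_self _ _
  have h : ∀ ζ : Key N T, table₃ v r K₀ U m x ζ =
      (if ζ = ⟨0, h0⟩ then r x * (1 - U / ∑ i, r i) else 0) +
        imbalance (table₂ v) m ζ * (r x / ∑ i, r i) := fun ζ => by
    by_cases hζ : ζ.1 = 0
    · rw [if_pos (Subtype.ext hζ), hv.imbalance_of_eq_zero hTN m hζ, table₃, if_pos hζ]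
      ring
    · rw [if_neg fun h => hζ (congrArg Subtype.val h), hv.table₃_eq hTN hr U m x hζ, zero_add]
  simp only [h, Finset.sum_add_distrib, Finset.sum_ite_eq', Finset.mem_univ, if_true]
  rw [← Finset.sum_mul, ← totalImbalance, ← hU]
  ring

/-! ### The sum of the tables -/

/-- The common row sum of the tables. -/
noncomputable def keyLaw {N : ℕ} (T : ℕ) (α : ℝ) (P : Fin N → ℝ) (w : (Fin N → Fin 2) → ℝ)
    (ζ : Key N T) : ℝ :=
  if ζ.1 = 0 then ∑ x, part₃ T α P x - (T * entry (part₂ T α P) N - ∑ x, part₂ T α P x)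
  else hotWeight w ζ + anchorSum (part₂ T α P) ζ

theorem keyMarginal_constructionA {N T : ℕ} (hTN : T ≤ N) {α : ℝ} {P : Fin N → ℝ} (hm : Monotone P)
    (hS : SplitSpec T α P) (w : (Fin N → Fin 2) → ℝ) (m : Fin T) (ζ : Key N T) :
    keyMarginal (constructionA α P w m) ζ = keyLaw T α P w ζ := by
  have hv := hS.isStaircase
  have hN : 1 ≤ N := by have := hv.numNonzero_lt; omega
  have hR : ∑ x, part₃ T α P x = 0 → entry (part₂ T α P) N = 0 := fun h => by
    rw [entry_last _ hN, hS.eq_zero h]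
    rfl
  simp only [keyMarginal, constructionA, Finset.sum_add_distrib, keyLaw]
  split_ifs with hζ
  · have h1 : ∑ x, table₁ w m x ζ = 0 := Finset.sum_eq_zero fun x _ => by
      rw [table₁_eq, if_neg fun h => ne_zero_of_mem_slice h hζ]
    rw [h1, sum_table₂_of_eq_zero hTN hv hζ, ← hv.totalImbalance_eq hTN m]
    simp only [table₃, if_pos hζ]
    rw [← Finset.sum_mul]
    -- Division by zero gives 0, so the case of no third part needs `hS.eq_zero`: then there is no
    -- imbalance to fill.
    by_cases h0 : ∑ x, part₃ T α P x = 0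
    · rw [hv.totalImbalance_eq hTN, h0, hR h0, hS.eq_zero h0]
      simp
    · field_simp
      ring
  · obtain ⟨x₀, -, hs⟩ := sum_ite_mem_slice hTN ζ hζ m
    simp only [table₁_eq, hs, hv.table₃_eq hTN (mem_tail_of_part₃_ne_zero hm) _ m _ hζ]
    rw [← Finset.mul_sum, ← Finset.sum_div, add_assoc]
    congr 1
    by_cases h0 : ∑ x, part₃ T α P x = 0
    · have h2 : anchorSum (part₂ T α P) ζ = 0 := by
        rw [anchorSum, hR h0, zero_mul, ite_self]
      have h3 : ∑ x, table₂ (part₂ T α P) m x ζ = 0 :=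
        le_antisymm (by
          have := imbalance_nonneg (table₂ (part₂ T α P)) m ζ
          rw [hv.imbalance_eq hTN] at this
          linarith) (Finset.sum_nonneg fun x _ => hv.table₂_nonneg hTN m x ζ)
      rw [h0, h2, h3]
      simp
    · rw [div_self h0, hv.imbalance_eq hTN]
      ring

theorem table₃_nonneg {N T : ℕ} (hTN : T ≤ N) {α : ℝ} {P : Fin N → ℝ} (hm : Monotone P)
    (hS : SplitSpec T α P) (m : Fin T) (x : Fin N) (ζ : Key N T) :
    0 ≤ table₃ (part₂ T α P) (part₃ T α P) (numLarge T α P)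
      (totalImbalance (T := T) (table₂ (part₂ T α P)) m) m x ζ := by
  have hv := hS.isStaircase
  have hN : 1 ≤ N := by have := hv.numNonzero_lt; omega
  have hR : 0 ≤ ∑ x, part₃ T α P x := Finset.sum_nonneg fun x _ => part₃_nonneg T α P x
  by_cases hζ : ζ.1 = 0
  · rw [table₃, if_pos hζ, hv.totalImbalance_eq hTN]
    refine mul_nonneg (part₃_nonneg T α P x) (sub_nonneg.2 (div_le_one_of_le₀ ?_ hR))
    rw [entry_last _ hN]
    exact hS.imbalance_le _
  · rw [hv.table₃_eq hTN (mem_tail_of_part₃_ne_zero hm) _ m _ hζ]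
    exact mul_nonneg (imbalance_nonneg _ _ _) (div_nonneg (part₃_nonneg T α P x) hR)

theorem constructionA_nonneg {N T : ℕ} (hTN : T ≤ N) {α : ℝ} {P : Fin N → ℝ} (hm : Monotone P)
    (hS : SplitSpec T α P) {w : (Fin N → Fin 2) → ℝ} (hw : IsHotRepresentation T w (part₁ T α P))
    (m : Fin T) (x : Fin N) (ζ : Key N T) : 0 ≤ constructionA α P w m x ζ := by
  refine add_nonneg (add_nonneg ?_ (hS.isStaircase.table₂_nonneg hTN m x ζ))
    (table₃_nonneg hTN hm hS m x ζ)
  rw [table₁_eq]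
  split_ifs
  · exact hotWeight_nonneg hw ζ
  · exact le_rfl

theorem columnSumInvariant_constructionA {N T : ℕ} (hTN : T ≤ N) {α : ℝ} {P : Fin N → ℝ}
    (hm : Monotone P) (hS : SplitSpec T α P) {w : (Fin N → Fin 2) → ℝ}
    (hw : IsHotRepresentation T w (part₁ T α P)) :
    ColumnSumInvariant (T := T) P (constructionA α P w) := fun m x => by
  have hv := hS.isStaircase
  have hT : 1 ≤ T := by have := hv.numNonzero_lt; omega
  simp only [constructionA, Finset.sum_add_distrib]
  rw [sum_table₁ hT hTN hw, hv.sum_table₂ hTN, hv.sum_table₃ hTN (mem_tail_of_part₃_ne_zero hm),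
    part₁_add_part₂, capped_add_part₃]

theorem constructionA_mem_stdSimplex {N T : ℕ} (hTN : T ≤ N) {α : ℝ} {P : Fin N → ℝ}
    (hP : P ∈ stdSimplex ℝ (Fin N)) (hm : Monotone P) (hS : SplitSpec T α P)
    {w : (Fin N → Fin 2) → ℝ} (hw : IsHotRepresentation T w (part₁ T α P)) (m : Fin T) :
    (fun p : Fin N × Key N T => constructionA α P w m p.1 p.2) ∈
      stdSimplex ℝ (Fin N × Key N T) := by
  refine ⟨fun p => constructionA_nonneg hTN hm hS hw m p.1 p.2, ?_⟩
  rw [Fintype.sum_prod_type]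
  simp only [columnSumInvariant_constructionA hTN hm hS hw m, hP.2]

theorem rowSumInvariant_constructionA {N T : ℕ} (hTN : T ≤ N) {α : ℝ} {P : Fin N → ℝ}
    (hm : Monotone P) (hS : SplitSpec T α P) (w : (Fin N → Fin 2) → ℝ) :
    RowSumInvariant (T := T) (constructionA α P w) := fun m m' ζ => by
  rw [keyMarginal_constructionA hTN hm hS, keyMarginal_constructionA hTN hm hS]

/-- The first two tables live on correct decodings and their column sums already add up to the cap;
the third can only add. -/
theorem cappedColumnSum_constructionA {N T : ℕ} (hTN : T ≤ N) {α : ℝ} {P : Fin N → ℝ}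
    (hm : Monotone P) (hS : SplitSpec T α P) {w : (Fin N → Fin 2) → ℝ}
    (hw : IsHotRepresentation T w (part₁ T α P)) :
    CappedColumnSum (T := T) α P (decoder N T) (constructionA α P w) := fun m x => by
  have hv := hS.isStaircase
  have hT : 1 ≤ T := by have := hv.numNonzero_lt; omega
  have h : min (α / T) (P x) = ∑ ζ, (table₁ w m x ζ + table₂ (part₂ T α P) m x ζ) := by
    rw [Finset.sum_add_distrib, sum_table₁ hT hTN hw, hv.sum_table₂ hTN, part₁_add_part₂, capped]
  rw [h]
  refine Finset.sum_le_sum fun ζ _ => ?_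
  have hd : decoder N T x ζ = m.succ ↔ ζ ∈ slice x m := mem_slice.symm
  have h3 := table₃_nonneg hTN hm hS m x ζ
  simp only [hd]
  by_cases hζ : ζ ∈ slice x m
  · rw [if_pos hζ, mul_one, constructionA]
    linarith
  · rw [if_neg hζ, mul_zero, table₁_eq, if_neg hζ, hv.table₂_eq hTN, if_neg hζ, add_zero]

/-- Each message contributes `part₁` x from the first table. A key decodes x to at most one message,
so the anchored part contributes at most the total of `anchorSum`, which is T · v(N); `add_le`
concludes. -/
theorem boundedTotalSum_keyLaw {N T : ℕ} (hTN : T ≤ N) {α : ℝ} {P : Fin N → ℝ}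
    (hS : SplitSpec T α P) {w : (Fin N → Fin 2) → ℝ}
    (hw : IsHotRepresentation T w (part₁ T α P)) :
    BoundedTotalSum α (decoder N T) (keyLaw T α P w) := fun x => by
  have hv := hS.isStaircase
  have hT : 1 ≤ T := by have := hv.numNonzero_lt; omega
  have hTR : (0 : ℝ) < T := by exact_mod_cast hT
  have hp := (hv.card_anchored_pos hTN)
  have hd : ∀ (m : Fin T) ζ, decoder N T x ζ = m.succ ↔ ζ ∈ slice x m := fun m ζ => mem_slice.symm
  have hterm : ∀ (m : Fin T) (ζ : Key N T),
      keyLaw T α P w ζ * (if decoder N T x ζ = m.succ then 1 else 0) =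
        table₁ w m x ζ + if ζ ∈ slice x m then anchorSum (part₂ T α P) ζ else 0 := fun m ζ => by
    simp only [hd]
    by_cases hζ : ζ ∈ slice x m
    · rw [if_pos hζ, if_pos hζ, table₁_eq, if_pos hζ, keyLaw, if_neg (ne_zero_of_mem_slice hζ),
        mul_one]
    · rw [if_neg hζ, if_neg hζ, table₁_eq, if_neg hζ, mul_zero, add_zero]
  simp only [hterm, Finset.sum_add_distrib, sum_table₁ hT hTN hw]
  have h2 : ∑ m : Fin T, ∑ ζ, (if ζ ∈ slice x m then anchorSum (part₂ T α P) ζ else 0) ≤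
      T * entry (part₂ T α P) N := by
    have hle : ∀ ζ : Key N T, ∑ m : Fin T, (if ζ ∈ slice x m then anchorSum (part₂ T α P) ζ else 0)
        ≤ anchorSum (part₂ T α P) ζ := fun ζ => by
      have h0 : 0 ≤ anchorSum (part₂ T α P) ζ := by
        unfold anchorSum
        split_ifs
        · refine mul_nonneg ?_ (anchorWeight_nonneg _)
          exact (hv.nonneg x).trans (hv.le_entry_last x)
        · exact le_rfl
      simp only [mem_slice]
      rcases Fin.eq_zero_or_eq_succ (ζ.1 x) with h | ⟨n, h⟩
      · simpa [h, (Fin.succ_ne_zero _).symm] using h0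
      · simp [h]
    rw [Finset.sum_comm]
    refine (Finset.sum_le_sum fun ζ _ => hle ζ).trans_eq ?_
    unfold anchorSum anchorWeight
    rw [Finset.sum_ite_mem, Finset.univ_inter, Finset.sum_const, nsmul_eq_mul]
    field_simp
  have h3 : T * part₁ T α P x + T * entry (part₂ T α P) N ≤ α := by
    rw [entry_last _ (by omega), ← mul_add]
    refine (mul_le_mul_of_nonneg_left (hS.add_le x _) hTR.le).trans_eq ?_
    field_simp
  rw [Finset.sum_const, Finset.card_univ, Fintype.card_fin, nsmul_eq_mul]
  linarith

/-! ### Optimality -/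

theorem sum_ite_eq_succ {T : ℕ} (a : Fin (T + 1)) :
    ∑ m : Fin T, (if a = m.succ then (1 : ℝ) else 0) = if a ≠ 0 then 1 else 0 := by
  rcases Fin.eq_zero_or_eq_succ a with rfl | ⟨n, rfl⟩
  · simp [(Fin.succ_ne_zero _).symm]
  · simp

theorem sum_sum_ite_eq_succ {N T : ℕ} {Z : Type} [Fintype Z] (γ : Fin N → Z → Fin (T + 1))
    (PZ : Z → ℝ) (x : Fin N) : ∑ m : Fin T, ∑ ζ, PZ ζ * (if γ x ζ = m.succ then 1 else 0) =
      ∑ ζ, PZ ζ * (if γ x ζ ≠ 0 then 1 else 0) := by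
  rw [Finset.sum_comm]
  simp only [← Finset.mul_sum, sum_ite_eq_succ]

theorem detectionError_prod {N T : ℕ} {Z : Type} [Fintype Z] (γ : Fin N → Z → Fin (T + 1))
    (m : Fin (T + 1)) (PZ : Z → ℝ) (QX : Fin N → ℝ) : detectionError γ m (fun x ζ => QX x * PZ ζ) =
      ∑ x, QX x * ∑ ζ, PZ ζ * (if γ x ζ ≠ m then 1 else 0) := by
  simp only [detectionError, Finset.mul_sum, mul_assoc]

theorem BoundedTotalSum.detectionError_le {N T : ℕ} {Z : Type} [Fintype Z] {α : ℝ}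
    {γ : Fin N → Z → Fin (T + 1)} {PZ : Z → ℝ} (h : BoundedTotalSum α γ PZ) {QX : Fin N → ℝ}
    (hQ : QX ∈ stdSimplex ℝ (Fin N)) : detectionError γ 0 (fun x ζ => QX x * PZ ζ) ≤ α := by
  rw [detectionError_prod]
  calc _ ≤ ∑ x, QX x * α := Finset.sum_le_sum fun x _ => mul_le_mul_of_nonneg_left (by
        rw [← sum_sum_ite_eq_succ]; exact h x) (hQ.1 x)
    _ = α := by rw [← Finset.sum_mul, hQ.2, one_mul]

theorem IsFeasible.boundedTotalSum {N T : ℕ} {Z : Type} [Fintype Z] {α : ℝ} {P : Fin N → ℝ}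
    {γ : Fin N → Z → Fin (T + 1)} {PZ : Z → ℝ} {Q : Fin T → Fin N → Z → ℝ}
    (h : IsFeasible α P γ PZ Q) : BoundedTotalSum α γ PZ := fun x => by
  -- The worst token distribution is a point mass.
  have := h.false_alarm _ (single_mem_stdSimplex ℝ x)
  rw [detectionError_prod] at this
  rw [sum_sum_ite_eq_succ]
  simpa [Pi.single_apply] using this

theorem IsFeasible.detectionError_eq {N T : ℕ} {Z : Type} [Fintype Z] {α : ℝ} {P : Fin N → ℝ}
    {γ : Fin N → Z → Fin (T + 1)} {PZ : Z → ℝ} {Q : Fin T → Fin N → Z → ℝ}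
    (h : IsFeasible α P γ PZ Q) (m : Fin T) : detectionError γ m.succ (Q m) =
      1 - ∑ x, ∑ ζ, Q m x ζ * (if γ x ζ = m.succ then 1 else 0) := by
  have h1 := (h.table_mem m).2
  rw [Fintype.sum_prod_type] at h1
  rw [eq_sub_iff_add_eq, detectionError]
  simp only [← Finset.sum_add_distrib]
  refine Eq.trans (Finset.sum_congr rfl fun x _ => Finset.sum_congr rfl fun ζ _ => ?_) h1
  by_cases hγ : γ x ζ = m.succ <;> simp [hγ]

theorem detectionError_le_worstMiss {N T : ℕ} {Z : Type} [Fintype Z] (γ : Fin N → Z → Fin (T + 1))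
    (Q : Fin T → Fin N → Z → ℝ) (m : Fin T) : detectionError γ m.succ (Q m) ≤ worstMiss γ Q :=
  le_ciSup (f := fun m : Fin T => detectionError γ m.succ (Q m)) (Set.finite_range _).bddAbove m

/-- No feasible scheme does better than `1 - ∑ x, min (α / T) (P x)`. -/
theorem IsFeasible.le_worstMiss {N T : ℕ} (hT : 1 ≤ T) {Z : Type} [Fintype Z] {α : ℝ}
    {P : Fin N → ℝ} {γ : Fin N → Z → Fin (T + 1)} {PZ : Z → ℝ} {Q : Fin T → Fin N → Z → ℝ}
    (h : IsFeasible α P γ PZ Q) : 1 - ∑ x, min (α / T) (P x) ≤ worstMiss γ Q := by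
  have hTR : (0 : ℝ) < T := by exact_mod_cast hT
  have hQ : ∀ m x ζ, 0 ≤ Q m x ζ := fun m x ζ => (h.table_mem m).1 (x, ζ)
  have hone : ∀ (m : Fin T) x ζ, (0 : ℝ) ≤ if γ x ζ = m.succ then 1 else 0 := fun m x ζ => by
    split_ifs <;> norm_num
  have hx : ∀ x, ∑ m : Fin T, ∑ ζ, Q m x ζ * (if γ x ζ = m.succ then 1 else 0) ≤
      T * min (α / T) (P x) := fun x => by
    -- The two arguments of the minimum are bounded separately: α through the row sums, T · P x
    -- through the column sums.
    rw [mul_min_of_nonneg _ _ hTR.le, mul_div_cancel₀ _ hTR.ne']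
    refine le_min ?_ ?_
    · refine (Finset.sum_le_sum fun m _ => Finset.sum_le_sum fun ζ _ =>
        mul_le_mul_of_nonneg_right ?_ (hone m x ζ)).trans (h.boundedTotalSum x)
      rw [← h.row_sum m]
      exact Finset.single_le_sum (f := fun y => Q m y ζ) (fun y _ => hQ m y ζ) (Finset.mem_univ x)
    · calc _ ≤ ∑ m : Fin T, P x := Finset.sum_le_sum fun m _ => by
            rw [← h.column_sum m x]
            refine Finset.sum_le_sum fun ζ _ => mul_le_of_le_one_right (hQ m x ζ) ?_
            split_ifs <;> norm_num
        _ = T * P x := by simp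
  have h1 : ∑ m : Fin T, detectionError γ m.succ (Q m) ≤ T * worstMiss γ Q := by
    refine (Finset.sum_le_sum fun m _ => detectionError_le_worstMiss γ Q m).trans_eq ?_
    simp
  simp only [h.detectionError_eq, Finset.sum_sub_distrib] at h1
  rw [Finset.sum_comm] at h1
  have h2 := Finset.sum_le_sum fun x (_ : x ∈ Finset.univ) => hx x
  rw [← Finset.mul_sum] at h2
  simp only [Finset.sum_const, Finset.card_univ, Fintype.card_fin, nsmul_eq_mul, mul_one] at h1
  refine le_of_mul_le_mul_left ?_ hTR
  linarith

theorem IsFeasible.worstMiss_eq {N T : ℕ} (hT : 1 ≤ T) {Z : Type} [Fintype Z] {α : ℝ}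
    {P : Fin N → ℝ} {γ : Fin N → Z → Fin (T + 1)} {PZ : Z → ℝ} {Q : Fin T → Fin N → Z → ℝ}
    (h : IsFeasible α P γ PZ Q) (hc : CappedColumnSum α P γ Q) :
    worstMiss γ Q = 1 - ∑ x, min (α / T) (P x) := by
  have : Nonempty (Fin T) := ⟨⟨0, hT⟩⟩
  refine le_antisymm (ciSup_le fun m => ?_) (h.le_worstMiss hT)
  rw [h.detectionError_eq]
  exact sub_le_sub_left (Finset.sum_le_sum fun x _ => hc m x) 1

theorem IsFeasible.isLeast {N T : ℕ} (hT : 1 ≤ T) {Z : Type} [Fintype Z] {α : ℝ}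
    {P : Fin N → ℝ} {γ : Fin N → Z → Fin (T + 1)} {PZ : Z → ℝ} {Q : Fin T → Fin N → Z → ℝ}
    (h : IsFeasible α P γ PZ Q) (hc : CappedColumnSum α P γ Q) :
    IsLeast (attainableErrors T α P) (worstMiss γ Q) := by
  refine ⟨⟨Z, _, γ, PZ, Q, h, rfl⟩, ?_⟩
  rintro _ ⟨Z', _, γ', PZ', Q', h', rfl⟩
  rw [h.worstMiss_eq hT hc]
  exact h'.le_worstMiss hT

theorem isFeasible_constructionA {N T : ℕ} (hTN : T ≤ N) {α : ℝ} {P : Fin N → ℝ}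
    (hP : P ∈ stdSimplex ℝ (Fin N)) (hm : Monotone P) (hS : SplitSpec T α P)
    {w : (Fin N → Fin 2) → ℝ} (hw : IsHotRepresentation T w (part₁ T α P)) (m : Fin T) :
    IsFeasible α P (decoder N T) (keyMarginal (constructionA α P w m)) (constructionA α P w) where
  key_mem := by
    refine ⟨fun ζ => Finset.sum_nonneg fun x _ => constructionA_nonneg hTN hm hS hw m x ζ, ?_⟩
    simp only [keyMarginal]
    rw [Finset.sum_comm]
    simp only [columnSumInvariant_constructionA hTN hm hS hw m, hP.2]
  table_mem := constructionA_mem_stdSimplex hTN hP hm hS hw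
  false_alarm QX hQ := by
    rw [funext (keyMarginal_constructionA hTN hm hS w m)]
    exact (boundedTotalSum_keyLaw hTN hS hw).detectionError_le hQ
  column_sum := columnSumInvariant_constructionA hTN hm hS hw
  row_sum m' ζ := rowSumInvariant_constructionA hTN hm hS w m' m ζ

/-! ### Permuting the tokens -/

/-- Permute the tokens of a key. -/
def permuteKey {N T : ℕ} (hTN : T ≤ N) (σ : Equiv.Perm (Fin N)) : Key N T ≃ Key N T where
  toFun ζ := ⟨ζ.1 ∘ σ, relabel_mem σ (Equiv.refl _) hTN ζ.2 fun _ _ => Iff.rfl⟩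
  invFun ζ := ⟨ζ.1 ∘ σ.symm, relabel_mem σ.symm (Equiv.refl _) hTN ζ.2 fun _ _ => Iff.rfl⟩
  left_inv ζ := Subtype.ext (funext fun x => by simp)
  right_inv ζ := Subtype.ext (funext fun x => by simp)

theorem decoder_permuteKey {N T : ℕ} (hTN : T ≤ N) (σ : Equiv.Perm (Fin N)) (x : Fin N)
    (ζ : Key N T) : decoder N T (σ.symm x) (permuteKey hTN σ ζ) = decoder N T x ζ := by
  simp [decoder, permuteKey]

/-- Permuting tokens and keys together preserves decoding; since the false-alarm condition covers
every token distribution, it can be pulled back along σ. -/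
theorem IsFeasible.permute {N T : ℕ} (hTN : T ≤ N) (σ : Equiv.Perm (Fin N)) {α : ℝ} {P : Fin N → ℝ}
    {PZ : Key N T → ℝ} {Q : Fin T → Fin N → Key N T → ℝ}
    (h : IsFeasible α (P ∘ σ) (decoder N T) PZ Q) :
    IsFeasible α P (decoder N T) (PZ ∘ permuteKey hTN σ)
      (fun m x ζ => Q m (σ.symm x) (permuteKey hTN σ ζ)) where
  key_mem := ⟨fun ζ => h.key_mem.1 _, by
    rw [← h.key_mem.2]; exact Equiv.sum_comp (permuteKey hTN σ) PZ⟩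
  table_mem m := ⟨fun p => (h.table_mem m).1 (σ.symm p.1, permuteKey hTN σ p.2), by
    rw [← (h.table_mem m).2]
    exact Equiv.sum_comp (σ.symm.prodCongr (permuteKey hTN σ)) fun p => Q m p.1 p.2⟩
  false_alarm QX hQ := by
    have h1 := h.false_alarm (QX ∘ σ) ⟨fun x => hQ.1 _, by
      rw [← hQ.2]; exact Equiv.sum_comp σ QX⟩
    refine le_of_eq_of_le ?_ h1
    rw [detectionError_prod, detectionError_prod]
    conv_rhs => rw [← Equiv.sum_comp σ.symm]
    refine Finset.sum_congr rfl fun x _ => ?_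
    conv_rhs => rw [← Equiv.sum_comp (permuteKey hTN σ)]
    simp only [decoder_permuteKey, Function.comp_apply, Equiv.apply_symm_apply]
  column_sum m x := by
    rw [Equiv.sum_comp (permuteKey hTN σ) fun ζ => Q m (σ.symm x) ζ, h.column_sum]
    simp
  row_sum m ζ := by
    rw [Equiv.sum_comp σ.symm fun x => Q m x (permuteKey hTN σ ζ), h.row_sum]
    rfl

theorem CappedColumnSum.permute {N T : ℕ} (hTN : T ≤ N) (σ : Equiv.Perm (Fin N)) {α : ℝ}
    {P : Fin N → ℝ} {Q : Fin T → Fin N → Key N T → ℝ}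
    (h : CappedColumnSum α (P ∘ σ) (decoder N T) Q) :
    CappedColumnSum α P (decoder N T)
      (fun m x ζ => Q m (σ.symm x) (permuteKey hTN σ ζ)) := fun m x => by
  have h1 := h m (σ.symm x)
  rw [← Equiv.sum_comp (permuteKey hTN σ)] at h1
  simpa only [decoder_permuteKey, Function.comp_apply, Equiv.apply_symm_apply] using h1

end Watermark

/-! ### The proposition -/

theorem proposition8 (N T : ℕ) (hT : 1 ≤ T) (hTN : T ≤ N) (α : ℝ) (hα₀ : 0 ≤ α) (hα₁ : α < 1)
    (P : Fin N → ℝ) (hP : P ∈ stdSimplex ℝ (Fin N)) :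
    -- the construction, for a non-decreasing token distribution
    (Monotone P →
      -- the split
      ((∀ x, part₁ T α P x + part₂ T α P x + part₃ T α P x = P x) ∧
        IsHotRepresentable T (part₁ T α P) ∧
        (∀ x, 0 ≤ part₂ T α P x) ∧ Monotone (part₂ T α P) ∧
        numNonzero (part₂ T α P) < T ∧
        (∀ x, part₂ T α P x ≠ 0 ↔ x ∈ tail N (numNonzero (part₂ T α P)))) ∧
      -- the tables, for every representation of the first part by `T`-hot vectors
      ∀ w : (Fin N → Fin 2) → ℝ, IsHotRepresentation T w (part₁ T α P) →
        (∀ m : Fin T, (fun p : Fin N × Key N T => constructionA α P w m p.1 p.2) ∈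
          stdSimplex ℝ (Fin N × Key N T)) ∧
        RowSumInvariant (T := T) (constructionA α P w) ∧
        ColumnSumInvariant (T := T) P (constructionA α P w) ∧
        CappedColumnSum α P (decoder N T) (constructionA α P w) ∧
        (∀ m : Fin T, BoundedTotalSum α (decoder N T) (keyMarginal (constructionA α P w m))) ∧
        -- optimality
        (∀ m : Fin T, IsFeasible α P (decoder N T) (keyMarginal (constructionA α P w m))
          (constructionA α P w)) ∧
        worstMiss (decoder N T) (constructionA α P w) = 1 - ∑ x, min (α / T) (P x) ∧
        IsLeast (attainableErrors T α P) (worstMiss (decoder N T) (constructionA α P w))) ∧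
    -- the reduced key set attains the optimum, for every token distribution
    (reducedKeySet N T).card = N ! / (N - T)! + 1 ∧
    ∃ (PZ : Key N T → ℝ) (Q : Fin T → Fin N → Key N T → ℝ),
      IsFeasible α P (decoder N T) PZ Q ∧
      worstMiss (decoder N T) Q = 1 - ∑ x, min (α / T) (P x) ∧
      IsLeast (attainableErrors T α P) (worstMiss (decoder N T) Q) := by
  refine ⟨fun hm => ?_, card_reducedKeySet hT hTN, ?_⟩
  · have hS := splitSpec hT hTN hα₀ hα₁ hP hm
    refine ⟨⟨fun x => ?_, hS.representable, hS.nonneg, hS.mono, hS.numNonzero_lt, hS.ne_zero_iff⟩,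
      fun w hw => ?_⟩
    · rw [part₁_add_part₂, capped_add_part₃]
    · have hF := isFeasible_constructionA hTN hP hm hS hw
      have hC := cappedColumnSum_constructionA hTN hm hS hw
      exact ⟨constructionA_mem_stdSimplex hTN hP hm hS hw,
        rowSumInvariant_constructionA hTN hm hS w, columnSumInvariant_constructionA hTN hm hS hw,
        hC, fun m => (hF m).boundedTotalSum, hF, (hF ⟨0, hT⟩).worstMiss_eq hT hC,
        (hF ⟨0, hT⟩).isLeast hT hC⟩
  -- Sort the token distribution, apply the monotone construction, and carry the scheme back; the
  -- key set is invariant under permutations of the tokens.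
  · have hP' : P ∘ Tuple.sort P ∈ stdSimplex ℝ (Fin N) :=
      ⟨fun x => hP.1 _, by rw [← hP.2]; exact Equiv.sum_comp (Tuple.sort P) P⟩
    have hm : Monotone (P ∘ Tuple.sort P) := Tuple.monotone_sort P
    have hS := splitSpec hT hTN hα₀ hα₁ hP' hm
    obtain ⟨w, hw⟩ := hS.representable
    have hF := (isFeasible_constructionA hTN hP' hm hS hw ⟨0, hT⟩).permute hTN
    have hC := (cappedColumnSum_constructionA hTN hm hS hw).permute hTN
    exact ⟨_, _, hF, hF.worstMiss_eq hT hC, hF.isLeast hT hC⟩
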